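/- Let $H_A,H_B$ be finite-dimensional complex Hilbert spaces and let $\mathcal X=\{\rho_i\}_{i=1}^N$, $N\ge 1$, be a finite set of states (positive semidefinite operators of trace one) on $H_A\otimes H_B$. For a state $\rho$ on $H_A\otimes H_B$ let $S(A|B,\rho)=S(\rho)-S(\mathrm{tr}_{H_A}\rho)$, where $S(\sigma)=-\mathrm{tr}(\sigma\log\sigma)$, and let $F(\rho,\sigma)=\|\sqrt\rho\sqrt\sigma\|_1^2$ be the fidelity; all logarithms are to base two. For $l\ge 1$, an $(l,k_l)$-protocol for one-way distillation is a map $\mathcal T_l=\sum_{j=1}^D\mathcal A_j\otimes\mathcal B_j$, with $D$ finite, where $\mathcal K^l$ is a Hilbert space of dimension $k_l$, the $\mathcal A_j$ are trace non-increasing completely positive maps from the operators on $H_A^{\otimes l}$ to the operators on $\mathcal K^l$ whose sum is trace preserving, and each $\mathcal B_j$ is a completely positive trace preserving map from the operators on $H_B^{\otimes l}$ to the operators on $\mathcal K^l$. A number $R\ge 0$ is an achievable rate for one-way entanglement distillation from $\mathcal X$ if there are $(l,k_l)$-protocols $\mathcal T_l$ and maximally entangled states $\phi_l$ on $\mathcal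 K^l\otimes\mathcal K^l$ ($l=1,2,\dots$) such that $$\liminf_{l\to\infty}\frac1l\log k_l\ \ge\ R\qquad\text{and}\qquad \lim_{l\to\infty}\ \inf_{\rho\in\mathcal X}F\big(\mathcal T_l(\rho^{\otimes l}),\phi_l\big)=1 .$$ Let $D_\rightarrow(\mathcal X)$ be the supremum of all achievable rates. Then $$D_\rightarrow(\mathcal X)\ \ge\ -\max_{1\le i\le N}S(A|B,\rho_i).$$ -/

import Mathlib

open scoped Matrix Kronecker ComplexOrder Topology

noncomputable section

namespace QInfo

/-- `ρ` is a state (density matrix): positive semidefinite with trace one. The finite-dimensional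
Hilbert space is `ℂ^m`, `m` a finite type; a composite system `AB` is indexed by `a × b`. -/
def IsState {m : Type*} [Fintype m] (ρ : Matrix m m ℂ) : Prop :=
  ρ.PosSemidef ∧ ρ.trace = 1

/-- The partial trace over the first tensor factor. -/
def traceFst {a b : Type*} [Fintype a] (M : Matrix (a × b) (a × b) ℂ) : Matrix b b ℂ :=
  Matrix.of fun j j' => ∑ i, M (i, j) (i, j')

/-- The partial trace over the second tensor factor. -/
def traceSnd {a b : Type*} [Fintype b] (M : Matrix (a × b) (a × b) ℂ) : Matrix a a ℂ :=
  Matrix.of fun i i' => ∑ j, M (i, j) (i', j)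

/-- The von Neumann entropy `S(ρ) = -tr (ρ log ρ)`, with the logarithm to base two
(`0 log 0 = 0`, since `Real.logb 2 0 = 0`). -/
def entropy {m : Type*} [Fintype m] [DecidableEq m] (ρ : Matrix m m ℂ) : ℝ :=
  -((ρ * cfc (Real.logb 2) ρ).trace).re

/-- The conditional von Neumann entropy `S(A|B, ρ) = S(ρ_AB) - S(ρ_B)`. -/
def condEntropy {a b : Type*} [Fintype a] [DecidableEq a] [Fintype b] [DecidableEq b]
    (ρ : Matrix (a × b) (a × b) ℂ) : ℝ :=
  entropy ρ - entropy (traceFst ρ)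

/-- The trace norm `‖X‖₁ = tr √(X* X)`. -/
def traceNorm {m : Type*} [Fintype m] [DecidableEq m] (X : Matrix m m ℂ) : ℝ :=
  ((cfc Real.sqrt (Xᴴ * X)).trace).re

/-- The fidelity `F(ρ, σ) = ‖√ρ √σ‖₁ ^ 2`. -/
def fidelity {m : Type*} [Fintype m] [DecidableEq m] (ρ σ : Matrix m m ℂ) : ℝ :=
  traceNorm (cfc Real.sqrt ρ * cfc Real.sqrt σ) ^ 2

/-- `Φ ⊗ id` on matrices over a product. -/
def mapFst {m n : Type*} (c : Type*) (Φ : Matrix m m ℂ →ₗ[ℂ] Matrix n n ℂ) :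
    Matrix (m × c) (m × c) ℂ →ₗ[ℂ] Matrix (n × c) (n × c) ℂ where
  toFun M := Matrix.of fun x y => Φ (Matrix.of fun i j => M (i, x.2) (j, y.2)) x.1 y.1
  map_add' M N := by
    ext x y
    exact congrFun (congrFun (map_add Φ (Matrix.of fun i j => M (i, x.2) (j, y.2))
      (Matrix.of fun i j => N (i, x.2) (j, y.2))) x.1) y.1
  map_smul' z M := by
    ext x y
    exact congrFun (congrFun (map_smul Φ z (Matrix.of fun i j => M (i, x.2) (j, y.2))) x.1) y.1

/-- `id ⊗ Φ` on matrices over a product. -/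
def mapSnd {m n : Type*} (c : Type*) (Φ : Matrix m m ℂ →ₗ[ℂ] Matrix n n ℂ) :
    Matrix (c × m) (c × m) ℂ →ₗ[ℂ] Matrix (c × n) (c × n) ℂ where
  toFun M := Matrix.of fun x y => Φ (Matrix.of fun i j => M (x.1, i) (y.1, j)) x.2 y.2
  map_add' M N := by
    ext x y
    exact congrFun (congrFun (map_add Φ (Matrix.of fun i j => M (x.1, i) (y.1, j))
      (Matrix.of fun i j => N (x.1, i) (y.1, j))) x.2) y.2
  map_smul' z M := by
    ext x y
    exact congrFun (congrFun (map_smul Φ z (Matrix.of fun i j => M (x.1, i) (y.1, j))) x.2) y.2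

/-- The tensor product `Φ ⊗ Ψ = (id ⊗ Ψ) ∘ (Φ ⊗ id)` of two linear maps between matrix algebras. -/
def tensorMap {m n p q : Type*} (Φ : Matrix m m ℂ →ₗ[ℂ] Matrix n n ℂ)
    (Ψ : Matrix p p ℂ →ₗ[ℂ] Matrix q q ℂ) :
    Matrix (m × p) (m × p) ℂ →ₗ[ℂ] Matrix (n × q) (n × q) ℂ :=
  mapSnd n Ψ ∘ₗ mapFst p Φ

/-- On product matrices `Φ ⊗ Ψ` acts as it should. -/
theorem tensorMap_kronecker {m n p q : Type*} (Φ : Matrix m m ℂ →ₗ[ℂ] Matrix n n ℂ)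
    (Ψ : Matrix p p ℂ →ₗ[ℂ] Matrix q q ℂ) (A : Matrix m m ℂ) (B : Matrix p p ℂ) :
    tensorMap Φ Ψ (A ⊗ₖ B) = Φ A ⊗ₖ Ψ B := by
  have h1 : mapFst p Φ (A ⊗ₖ B) = Φ A ⊗ₖ B := by
    ext x y
    have h : (Matrix.of fun i j => (A ⊗ₖ B) (i, x.2) (j, y.2)) = B x.2 y.2 • A := by
      ext i j
      simp [mul_comm]
    change Φ (Matrix.of fun i j => (A ⊗ₖ B) (i, x.2) (j, y.2)) x.1 y.1 = _
    rw [h, map_smul]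
    simp [Matrix.kroneckerMap_apply, mul_comm]
  ext x y
  have h : (Matrix.of fun i j => (Φ A ⊗ₖ B) (x.1, i) (y.1, j)) = Φ A x.1 y.1 • B := by
    ext i j
    simp
  change Ψ (Matrix.of fun i j => mapFst p Φ (A ⊗ₖ B) (x.1, i) (y.1, j)) x.2 y.2 = _
  rw [h1, h, map_smul]
  simp [Matrix.kroneckerMap_apply]

/-- Complete positivity: every amplification `id_k ⊗ Φ` preserves positive semidefiniteness. -/
def IsCP {m n : Type*} (Φ : Matrix m m ℂ →ₗ[ℂ] Matrix n n ℂ) : Prop :=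
  ∀ (k : ℕ) (M : Matrix (Fin k × m) (Fin k × m) ℂ),
    M.PosSemidef → (mapSnd (Fin k) Φ M).PosSemidef

/-- `Φ` preserves the trace. -/
def IsTracePreserving {m n : Type*} [Fintype m] [Fintype n]
    (Φ : Matrix m m ℂ →ₗ[ℂ] Matrix n n ℂ) : Prop :=
  ∀ M : Matrix m m ℂ, (Φ M).trace = M.trace

/-- A channel: a completely positive and trace preserving map. -/
def IsChannel {m n : Type*} [Fintype m] [Fintype n]
    (Φ : Matrix m m ℂ →ₗ[ℂ] Matrix n n ℂ) : Prop :=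
  IsCP Φ ∧ IsTracePreserving Φ

/-- A trace non-increasing completely positive map. -/
def IsSubchannel {m n : Type*} [Fintype m] [Fintype n]
    (Φ : Matrix m m ℂ →ₗ[ℂ] Matrix n n ℂ) : Prop :=
  IsCP Φ ∧ ∀ M : Matrix m m ℂ, M.PosSemidef → (Φ M).trace.re ≤ M.trace.re

/-- A finite instrument: trace non-increasing completely positive maps whose sum is trace
preserving. -/
def IsInstrument {m n : Type*} [Fintype m] [Fintype n] {D : ℕ}
    (𝒜 : Fin D → Matrix m m ℂ →ₗ[ℂ] Matrix n n ℂ) : Prop :=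
  (∀ j, IsSubchannel (𝒜 j)) ∧ IsTracePreserving (∑ j, 𝒜 j)

/-- LOCC channels with one-way classical communication from `A` to `B`: `T = ∑ j, 𝒜 j ⊗ ℬ j` with
an instrument `𝒜` on the `A` side and a channel `ℬ j` on the `B` side for each outcome `j`. -/
def IsOneWayLOCC {a b c d : Type*} [Fintype a] [Fintype b] [Fintype c] [Fintype d]
    (T : Matrix (a × b) (a × b) ℂ →ₗ[ℂ] Matrix (c × d) (c × d) ℂ) : Prop :=
  ∃ (D : ℕ) (𝒜 : Fin D → Matrix a a ℂ →ₗ[ℂ] Matrix c c ℂ)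
    (ℬ : Fin D → Matrix b b ℂ →ₗ[ℂ] Matrix d d ℂ),
    IsInstrument 𝒜 ∧ (∀ j, IsChannel (ℬ j)) ∧ T = ∑ j, tensorMap (𝒜 j) (ℬ j)

/-- The tensor power `ρ^{⊗ l}` of a bipartite matrix, as an operator on
`H_A^{⊗ l} ⊗ H_B^{⊗ l}`. -/
def tensorPow {a b : Type*} (l : ℕ) (ρ : Matrix (a × b) (a × b) ℂ) :
    Matrix ((Fin l → a) × (Fin l → b)) ((Fin l → a) × (Fin l → b)) ℂ :=
  Matrix.of fun x y => ∏ t, ρ (x.1 t, x.2 t) (y.1 t, y.2 t)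

/-- `φ` is a maximally entangled state on `ℂ^k ⊗ ℂ^k`: a rank-one projection `|ψ⟩⟨ψ|` both of
whose marginals are the maximally mixed state `1 / k`. -/
def IsMaxEntangled {k : ℕ} (φ : Matrix (Fin k × Fin k) (Fin k × Fin k) ℂ) : Prop :=
  IsState φ ∧ (∃ ψ : Fin k × Fin k → ℂ, φ = Matrix.vecMulVec ψ (star ψ)) ∧
    traceSnd φ = (k : ℂ)⁻¹ • (1 : Matrix (Fin k) (Fin k) ℂ) ∧
    traceFst φ = (k : ℂ)⁻¹ • (1 : Matrix (Fin k) (Fin k) ℂ)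

/-- `R ≥ 0` is an achievable rate for one-way entanglement distillation from the set `X`: there
are one-way LOCC protocols `T l` from `H_A^{⊗ l} ⊗ H_B^{⊗ l}` to `ℂ^(k l) ⊗ ℂ^(k l)`, `l ≥ 1`, with
`liminf (1 / l) log (k l) ≥ R` and `inf_{ρ ∈ X} F(T l (ρ^{⊗ l}), φ l) → 1` for maximally entangled
states `φ l`. The limit inferior is taken in the extended reals. -/
def IsAchievableRate {a b : Type*} [Fintype a] [Fintype b]
    (X : Set (Matrix (a × b) (a × b) ℂ)) (R : ℝ) : Prop :=
  0 ≤ R ∧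
  ∃ (k : ℕ → ℕ)
    (T : ∀ l : ℕ, Matrix ((Fin l → a) × (Fin l → b)) ((Fin l → a) × (Fin l → b)) ℂ →ₗ[ℂ]
      Matrix (Fin (k l) × Fin (k l)) (Fin (k l) × Fin (k l)) ℂ)
    (φ : ∀ l : ℕ, Matrix (Fin (k l) × Fin (k l)) (Fin (k l) × Fin (k l)) ℂ),
    (∀ l, 1 ≤ l → 1 ≤ k l ∧ IsOneWayLOCC (T l) ∧ IsMaxEntangled (φ l)) ∧
    (R : EReal) ≤
      Filter.liminf (fun l : ℕ => ((1 / (l : ℝ) * Real.logb 2 (k l) : ℝ) : EReal)) Filter.atTop ∧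
    Filter.Tendsto (fun l : ℕ => ⨅ ρ : X, fidelity (T l (tensorPow l ρ.1)) (φ l))
      Filter.atTop (𝓝 1)

/-- The one-way entanglement capacity `D_→(X)`: the supremum, in the extended reals, of the
achievable rates for one-way entanglement distillation. -/
def oneWayDistillable {a b : Type*} [Fintype a] [Fintype b]
    (X : Set (Matrix (a × b) (a × b) ℂ)) : EReal :=
  sSup {r : EReal | ∃ R : ℝ, r = (R : EReal) ∧ IsAchievableRate X R}

end QInfo

end

/-!
The bound is the hashing bound for a compound source. Three ideas carry the proof.

**Reduction to one state.** The fidelity with a pure state is linear (`fidelity_vecMulVec`). A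
protocol that distils from the uniform mixture of the `(ρ i)^{⊗ l}` with fidelity `1 - η` therefore
distils from each of them with fidelity at least `1 - N η`, and `N` is fixed. Bob never has to learn
which state is present.

**One shot** (`exists_oneShot_protocol`). Write the state as `∑ e, |ψ e⟩⟨ψ e|`; the label `e` is a
purifying environment. Alice applies a `k × dim A` matrix of independent random cube roots of unity.
As the entries are uncorrelated, these matrices are, after normalisation, the Kraus operators of an
exact instrument, so the randomness is part of her measurement and is announced to Bob. The marginal
`σ` of the encoded state on code space and environment has mean `(1/k) ⊗ ρ_E`, and by orthogonality
of the products of phases its variance is bounded by the squared norms of the coefficients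
(`sum_norm_encode_sub_decoupled_sq_le`). Bob then has to rotate his part of the pure state with
marginal `σ` to a maximally entangled state together with a purification of an operator `ω ≥ 0` on
the environment. For `τ = (1/k) ⊗ ω = T Tᴴ` he uses the contraction `2 Tᴴ (τ + σ)⁻¹ M`, where
`σ = M Mᴴ`. Its overlap with the target is `2 tr (σ (τ + σ)⁻¹ τ)`, and the arithmetic-harmonic mean
inequality bounds this below by `(3/2) tr σ - (1/2) tr (σ τ⁻¹ σ)`
(`exists_contraction_overlap`). Here `ω` is `ρ_E` plus a small diagonal matrix, which bounds `τ⁻¹`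
by a diagonal matrix in the fluctuation term (`sum_trace_encode_inv_le`).

**Typicality** (`exists_smoothed_vectors`). For a tensor power the eigenvectors are products. The
vectors are projected to the span of the eigenvectors of `ρ_B^{⊗ l}` with eigenvalue at most
`2^{-l (S(B) - δ)}`, and those with weight below `2^{-l (S(AB) + δ)}` are dropped. By Chebyshev's
inequality the lost weight vanishes as `l → ∞`. For the mixture this is done separately for each
`i`. The label `i` is part of the environment, so the error term is a sum over `i` of
`k 2^{l (S(A|B, ρ i) + 2 δ)}` up to a constant and the regularisation, and the largest conditional
entropy decides.
-/

noncomputable section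

namespace QInfo

open Matrix Finset

/-! ### Positive matrices and Bob's decoder -/

/-- Regularisation never increases the inverse: `ρ (ρ + D)⁻¹ ρ ≤ ρ`. -/
theorem posSemidef_sub_mul_inv_add_mul {n : Type*} [Fintype n] [DecidableEq n]
    {ρ D : Matrix n n ℂ} (hρ : ρ.PosSemidef) (hD : D.PosDef) :
    (ρ - ρ * (ρ + D)⁻¹ * ρ).PosSemidef := by
  have hω : (ρ + D).PosDef := by
    rw [add_comm]
    exact hD.add_posSemidef hρ
  have hdet : IsUnit (ρ + D).det := (Matrix.isUnit_iff_isUnit_det _).1 hω.isUnit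
  have h1 : (ρ + D)⁻¹ * (ρ + D) = 1 := Matrix.nonsing_inv_mul _ hdet
  have hI : ((ρ + D)⁻¹)ᴴ = (ρ + D)⁻¹ := hω.isHermitian.inv
  generalize (ρ + D)⁻¹ = I at h1 hI ⊢
  have h2 : I * ρ * I + I * D * I = I := by
    rw [← add_mul, ← mul_add, h1, one_mul]
  have h3 : ρ * (I * ρ * I) * ρ + ρ * (I * D * I) * ρ = ρ * I * ρ := by
    rw [← add_mul, ← mul_add, h2]
  -- Completing the square.
  have e : ρ - ρ * I * ρ = (1 - I * ρ)ᴴ * ρ * (1 - I * ρ) + (I * ρ)ᴴ * D * (I * ρ) := by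
    rw [conjTranspose_sub, conjTranspose_mul, hI, hρ.isHermitian.eq, conjTranspose_one]
    have : (1 - ρ * I) * ρ * (1 - I * ρ) + ρ * I * D * (I * ρ)
        = ρ - ρ * I * ρ - ρ * I * ρ + (ρ * (I * ρ * I) * ρ + ρ * (I * D * I) * ρ) := by
      noncomm_ring
    rw [this, h3]
    abel
  rw [e]
  exact (hρ.conjTranspose_mul_mul_same _).add (hD.posSemidef.conjTranspose_mul_mul_same _)

/-- The inverse is antitone: `(ρ + D)⁻¹ ≤ D⁻¹`. -/
theorem posSemidef_inv_sub_inv_add {n : Type*} [Fintype n] [DecidableEq n]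
    {ρ D : Matrix n n ℂ} (hρ : ρ.PosSemidef) (hD : D.PosDef) :
    (D⁻¹ - (ρ + D)⁻¹).PosSemidef := by
  have hω : (ρ + D).PosDef := by
    rw [add_comm]
    exact hD.add_posSemidef hρ
  have h1 : (ρ + D)⁻¹ * (ρ + D) = 1 :=
    Matrix.nonsing_inv_mul _ ((Matrix.isUnit_iff_isUnit_det _).1 hω.isUnit)
  have h1' : (ρ + D) * (ρ + D)⁻¹ = 1 :=
    Matrix.mul_nonsing_inv _ ((Matrix.isUnit_iff_isUnit_det _).1 hω.isUnit)
  have h2 : D⁻¹ * D = 1 := Matrix.nonsing_inv_mul _ ((Matrix.isUnit_iff_isUnit_det _).1 hD.isUnit)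
  have h2' : D * D⁻¹ = 1 := Matrix.mul_nonsing_inv _ ((Matrix.isUnit_iff_isUnit_det _).1 hD.isUnit)
  have hI : ((ρ + D)⁻¹)ᴴ = (ρ + D)⁻¹ := hω.isHermitian.inv
  have hJ : D⁻¹.PosSemidef := hD.inv.posSemidef
  generalize (ρ + D)⁻¹ = I at *
  generalize D⁻¹ = J at *
  have e : J - I = Iᴴ * (ρ + ρᴴ * J * ρ) * I := by
    have h4 : (ρ + D) * (J - I) * (ρ + D) = ρ + ρ * J * ρ := by
      have : (ρ + D) * (J - I) * (ρ + D) = ρ * J * ρ + ρ * (J * D) + (D * J) * ρ + (D * J) * D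
          - ((ρ + D) * I) * (ρ + D) := by noncomm_ring
      rw [this, h2, h2', h1']
      simp only [mul_one, one_mul]
      abel
    rw [hI, hρ.isHermitian.eq, ← h4]
    calc J - I = (I * (ρ + D)) * (J - I) * ((ρ + D) * I) := by rw [h1, h1', one_mul, mul_one]
      _ = _ := by simp only [mul_assoc]
  rw [e]
  exact (hρ.add (hJ.conjTranspose_mul_mul_same _)).conjTranspose_mul_mul_same _

/-- `σ S⁻¹ σ ≤ (σ + σ τ⁻¹ σ) / 4` for `S = τ + σ`: the arithmetic-harmonic mean inequality. -/
theorem posSemidef_harmonic {n : Type*} [Fintype n] [DecidableEq n]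
    {σ τ : Matrix n n ℂ} (hσ : σ.PosSemidef) (hτ : τ.PosDef) :
    ((1 / 4 : ℂ) • (σ + σ * τ⁻¹ * σ) - σ * (τ + σ)⁻¹ * σ).PosSemidef := by
  have hS : (τ + σ).PosDef := hτ.add_posSemidef hσ
  have h1 : (τ + σ)⁻¹ * (τ + σ) = 1 :=
    Matrix.nonsing_inv_mul _ ((Matrix.isUnit_iff_isUnit_det _).1 hS.isUnit)
  have h2 : τ⁻¹ * τ = 1 := Matrix.nonsing_inv_mul _ ((Matrix.isUnit_iff_isUnit_det _).1 hτ.isUnit)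
  have h2' : τ * τ⁻¹ = 1 := Matrix.mul_nonsing_inv _ ((Matrix.isUnit_iff_isUnit_det _).1 hτ.isUnit)
  have hI : ((τ + σ)⁻¹)ᴴ = (τ + σ)⁻¹ := hS.isHermitian.inv
  have hJ : (τ⁻¹)ᴴ = τ⁻¹ := hτ.isHermitian.inv
  generalize (τ + σ)⁻¹ = I at *
  generalize τ⁻¹ = J at *
  have h3 : σ * (I * τ * I) * σ + σ * (I * σ * I) * σ = σ * I * σ := by
    rw [← add_mul, ← mul_add, ← add_mul, ← mul_add, h1, one_mul]
  -- Two squares, which measure how far `I * σ` is from `1 / 2` and from `J * σ / 2`.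
  have e : (1 / 4 : ℂ) • (σ + σ * J * σ) - σ * I * σ
      = (I * σ - (1 / 2 : ℂ) • 1)ᴴ * σ * (I * σ - (1 / 2 : ℂ) • 1)
        + (I * σ - (1 / 2 : ℂ) • (J * σ))ᴴ * τ * (I * σ - (1 / 2 : ℂ) • (J * σ)) := by
    have hs : star (1 / 2 : ℂ) = 1 / 2 := by simp
    simp only [conjTranspose_sub, conjTranspose_mul, conjTranspose_smul, hI, hJ,
      hσ.isHermitian.eq, conjTranspose_one, hs]
    have : (σ * I - (1 / 2 : ℂ) • 1) * σ * (I * σ - (1 / 2 : ℂ) • 1)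
        + (σ * I - (1 / 2 : ℂ) • (σ * J)) * τ * (I * σ - (1 / 2 : ℂ) • (J * σ))
        = (σ * (I * τ * I) * σ + σ * (I * σ * I) * σ) - (1 / 2 : ℂ) • (σ * I * σ)
          - (1 / 2 : ℂ) • (σ * I * σ) + (1 / 4 : ℂ) • σ
          - (1 / 2 : ℂ) • (σ * I * (τ * J) * σ) - (1 / 2 : ℂ) • (σ * (J * τ) * I * σ)
          + (1 / 4 : ℂ) • (σ * (J * τ) * J * σ) := by
      simp only [sub_mul, mul_sub, smul_mul_assoc, mul_smul_comm, one_mul, mul_one, smul_sub,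
        smul_smul, mul_assoc]
      module
    rw [this, h3, h2, h2']
    simp only [mul_one]
    module
  rw [e]
  exact (hσ.conjTranspose_mul_mul_same _).add (hτ.posSemidef.conjTranspose_mul_mul_same _)

/-- The decoder. `M` represents a pure state (rows: systems Bob does not hold, columns: Bob's) with
marginal `M Mᴴ`, and `T` a pure target state with marginal `τ = T Tᴴ`. The contraction
`C = 2 Tᴴ (τ + M Mᴴ)⁻¹ M` rotates `M` towards `T`, and the overlap it reaches is a trace of a
harmonic mean of the two marginals, hence close to one as soon as they agree up to second order.
It replaces the polar decomposition in Uhlmann's theorem. -/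
theorem exists_contraction_overlap {n b : Type*} [Fintype n] [DecidableEq n] [Fintype b]
    [DecidableEq b] (M : Matrix n b ℂ) {τ T : Matrix n n ℂ} (hτ : τ.PosDef) (hT : τ = T * Tᴴ) :
    ∃ C : Matrix n b ℂ, (1 - Cᴴ * C).PosSemidef ∧
      3 / 2 * (M * Mᴴ).trace.re - 1 / 2 * (M * Mᴴ * τ⁻¹ * (M * Mᴴ)).trace.re
        ≤ (Tᴴ * M * Cᴴ).trace.re := by
  have hσ : (M * Mᴴ).PosSemidef := posSemidef_self_mul_conjTranspose M
  have hS : (τ + M * Mᴴ).PosDef := hτ.add_posSemidef hσ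
  have h1 : (τ + M * Mᴴ)⁻¹ * (τ + M * Mᴴ) = 1 :=
    Matrix.nonsing_inv_mul _ ((Matrix.isUnit_iff_isUnit_det _).1 hS.isUnit)
  have hI : ((τ + M * Mᴴ)⁻¹)ᴴ = (τ + M * Mᴴ)⁻¹ := hS.isHermitian.inv
  have hh := posSemidef_harmonic hσ hτ
  refine ⟨(2 : ℂ) • (Tᴴ * (τ + M * Mᴴ)⁻¹ * M), ?_, ?_⟩
  · generalize (τ + M * Mᴴ)⁻¹ = I at *
    have h2 : I * (T * Tᴴ) * I = I - I * (M * Mᴴ) * I := by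
      rw [← hT, eq_sub_iff_add_eq, ← add_mul, ← mul_add, h1, one_mul]
    have hX : (Mᴴ * I * M)ᴴ = Mᴴ * I * M := by
      simp [conjTranspose_mul, hI, Matrix.mul_assoc]
    -- With `X = Mᴴ * I * M` the defect is `1 - 4 X + 4 X ^ 2`.
    have e : 1 - ((2 : ℂ) • (Tᴴ * I * M))ᴴ * ((2 : ℂ) • (Tᴴ * I * M))
        = (1 - (2 : ℂ) • (Mᴴ * I * M))ᴴ * (1 - (2 : ℂ) • (Mᴴ * I * M)) := by
      have h3 : Mᴴ * (I * (T * Tᴴ) * I) * M = Mᴴ * I * M - (Mᴴ * I * M) * (Mᴴ * I * M) := by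
        rw [h2]
        simp only [Matrix.mul_sub, Matrix.sub_mul, Matrix.mul_assoc]
      have h4 : ((2 : ℂ) • (Tᴴ * I * M))ᴴ * ((2 : ℂ) • (Tᴴ * I * M))
          = (4 : ℂ) • (Mᴴ * (I * (T * Tᴴ) * I) * M) := by
        simp only [conjTranspose_smul, conjTranspose_mul, hI, conjTranspose_conjTranspose,
          Matrix.smul_mul, Matrix.mul_smul, smul_smul, Matrix.mul_assoc]
        norm_num
      rw [h4, h3, conjTranspose_sub, conjTranspose_smul, hX, conjTranspose_one]
      generalize Mᴴ * I * M = X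
      have hs : star (2 : ℂ) = 2 := by simp
      simp only [hs, sub_mul, mul_sub, one_mul, mul_one, smul_mul_assoc, mul_smul_comm]
      module
    rw [e]
    exact posSemidef_conjTranspose_mul_self _
  · have h5 : (Tᴴ * M * ((2 : ℂ) • (Tᴴ * (τ + M * Mᴴ)⁻¹ * M))ᴴ).trace
        = 2 * ((M * Mᴴ).trace - (M * Mᴴ * (τ + M * Mᴴ)⁻¹ * (M * Mᴴ)).trace) := by
      have h6 : M * Mᴴ * (τ + M * Mᴴ)⁻¹ * (T * Tᴴ)
          = M * Mᴴ - M * Mᴴ * (τ + M * Mᴴ)⁻¹ * (M * Mᴴ) := by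
        rw [← hT, eq_sub_iff_add_eq, ← mul_add, mul_assoc, h1, mul_one]
      rw [← trace_sub, ← h6]
      have hs : star (2 : ℂ) = 2 := by simp
      rw [conjTranspose_smul, Matrix.mul_smul, trace_smul, hs, smul_eq_mul]
      congr 1
      simp only [conjTranspose_mul, hI, conjTranspose_conjTranspose, Matrix.mul_assoc]
      rw [trace_mul_comm]
      simp only [Matrix.mul_assoc]
    have h7 := (Complex.le_def.1 hh.trace_nonneg).1
    rw [h5]
    simp only [trace_sub, trace_smul, trace_add, smul_eq_mul, Complex.sub_re, Complex.zero_re,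
      Complex.mul_re, Complex.add_re] at h7 ⊢
    norm_num at h7 ⊢
    linarith

/-! ### Kraus maps -/

/-- The completely positive map `X ↦ ∑ i, K i X (K i)ᴴ` with Kraus operators `K i`. -/
def krausMap {m n ι : Type*} [Fintype m] [Fintype ι] (K : ι → Matrix n m ℂ) :
    Matrix m m ℂ →ₗ[ℂ] Matrix n n ℂ where
  toFun X := ∑ i, K i * X * (K i)ᴴ
  map_add' X Y := by simp only [Matrix.mul_add, Matrix.add_mul, sum_add_distrib]
  map_smul' z X := by
    simp only [Matrix.mul_smul, Matrix.smul_mul, ← smul_sum, RingHom.id_apply]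

theorem krausMap_apply {m n ι : Type*} [Fintype m] [Fintype ι] (K : ι → Matrix n m ℂ)
    (X : Matrix m m ℂ) : krausMap K X = ∑ i, K i * X * (K i)ᴴ := rfl

theorem krausMap_posSemidef {m n ι : Type*} [Fintype m] [Finite n] [Fintype ι]
    (K : ι → Matrix n m ℂ) {X : Matrix m m ℂ} (hX : X.PosSemidef) : (krausMap K X).PosSemidef :=
  posSemidef_sum _ fun i _ => hX.mul_mul_conjTranspose_same (K i)

theorem mapSnd_krausMap {m n ι c : Type*} [Fintype m] [Fintype ι] [Fintype c] [DecidableEq c]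
    (K : ι → Matrix n m ℂ) (M : Matrix (c × m) (c × m) ℂ) :
    mapSnd c (krausMap K) M = krausMap (fun i => (1 : Matrix c c ℂ) ⊗ₖ K i) M := by
  ext x y
  change krausMap K (Matrix.of fun i j => M (x.1, i) (y.1, j)) x.2 y.2 = _
  simp only [krausMap_apply, Matrix.sum_apply, Matrix.mul_apply, conjTranspose_apply, of_apply,
    Fintype.sum_prod_type, kroneckerMap_apply, Matrix.one_apply, ite_mul, one_mul, zero_mul]
  refine sum_congr rfl fun i _ => ?_
  rw [Fintype.sum_eq_single y.1 fun z hz => sum_eq_zero fun w _ => by simp [hz.symm]]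
  refine sum_congr rfl fun j _ => ?_
  rw [if_pos rfl, Fintype.sum_eq_single x.1 fun z hz => sum_eq_zero fun w _ => by simp [hz.symm]]
  simp

theorem krausMap_isCP {m n ι : Type*} [Fintype m] [Finite n] [Fintype ι]
    (K : ι → Matrix n m ℂ) : IsCP (krausMap K) := by
  intro k M hM
  rw [mapSnd_krausMap]
  exact krausMap_posSemidef _ hM

theorem trace_krausMap {m n ι : Type*} [Fintype m] [Fintype n] [Fintype ι]
    (K : ι → Matrix n m ℂ) (X : Matrix m m ℂ) :
    (krausMap K X).trace = ((∑ i, (K i)ᴴ * K i) * X).trace := by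
  rw [krausMap_apply, trace_sum, Matrix.sum_mul, trace_sum]
  exact sum_congr rfl fun i _ => by rw [trace_mul_comm, Matrix.mul_assoc]

/-- The tensor product of two Kraus maps is the Kraus map of the products of Kraus operators. -/
theorem tensorMap_krausMap {m n p q ι κ : Type*} [Fintype m] [DecidableEq m] [Fintype p]
    [DecidableEq p] [Fintype ι] [Fintype κ] (K : ι → Matrix n m ℂ) (L : κ → Matrix q p ℂ) :
    tensorMap (krausMap K) (krausMap L) = krausMap fun x : ι × κ => K x.1 ⊗ₖ L x.2 := by
  refine Matrix.ext_linearMap ℂ fun i j => LinearMap.ext_ring ?_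
  change tensorMap (krausMap K) (krausMap L) (Matrix.single i j 1)
    = krausMap (fun x : ι × κ => K x.1 ⊗ₖ L x.2) (Matrix.single i j 1)
  rw [show (Matrix.single i j (1 : ℂ)) = Matrix.single i.1 j.1 1 ⊗ₖ Matrix.single i.2 j.2 1 by
    rw [single_kronecker_single, one_mul], tensorMap_kronecker]
  simp only [krausMap_apply, Fintype.sum_prod_type, conjTranspose_kronecker,
    ← mul_kronecker_mul]
  ext x y
  simp only [kroneckerMap_apply, Matrix.sum_apply, sum_mul_sum]

/-- A family of Kraus operators, one for each outcome of a finite type, whose squares sum to the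
identity, is an instrument after any enumeration of the outcomes. -/
theorem isInstrument_krausMap {m n ι : Type*} [Fintype m] [DecidableEq m] [Fintype n] [Fintype ι]
    (K : ι → Matrix n m ℂ) (hK : ∑ i, (K i)ᴴ * K i = 1) {D : ℕ} (e : Fin D ≃ ι) :
    IsInstrument fun j => krausMap fun _ : Unit => K (e j) := by
  have htr : ∀ X : Matrix m m ℂ,
      ∑ i, (krausMap (fun _ : Unit => K i) X).trace = X.trace := fun X => by
    simp only [trace_krausMap, univ_unique, sum_singleton]
    rw [← trace_sum, ← Matrix.sum_mul, hK, Matrix.one_mul]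
  refine ⟨fun j => ⟨krausMap_isCP _, fun M hM => ?_⟩, fun M => ?_⟩
  · rw [← htr M, Complex.re_sum]
    exact single_le_sum (f := fun i => ((krausMap (fun _ : Unit => K i)) M).trace.re)
      (fun i _ => (Complex.le_def.1 (krausMap_posSemidef _ hM).trace_nonneg).1) (mem_univ (e j))
  · rw [LinearMap.sum_apply, trace_sum, ← htr M]
    exact Equiv.sum_comp e fun i => ((krausMap (fun _ : Unit => K i)) M).trace

/-- Kraus operators whose squares sum to at most the identity can be completed to those of a
channel: on the defect `1 - ∑ i, (K i)ᴴ * K i = Gᴴ * G` a fixed basis vector is prepared. -/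
theorem exists_kraus_completion {m n ι : Type*} [Fintype m] [DecidableEq m] [Fintype n]
    [DecidableEq n] [Nonempty n] [Fintype ι] (K : ι → Matrix n m ℂ)
    (hK : (1 - ∑ i, (K i)ᴴ * K i).PosSemidef) :
    ∃ L : m → Matrix n m ℂ, ∑ i, (K i)ᴴ * K i + ∑ j, (L j)ᴴ * L j = 1 := by
  obtain ⟨G, hG⟩ : ∃ G : Matrix m m ℂ, 1 - ∑ i, (K i)ᴴ * K i = Gᴴ * G := by
    open scoped MatrixOrder in
    obtain ⟨G, hG⟩ := CStarAlgebra.nonneg_iff_eq_star_mul_self.1 hK.nonneg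
    exact ⟨G, hG⟩
  obtain ⟨x⟩ := ‹Nonempty n›
  refine ⟨fun j => Matrix.single x j (1 : ℂ) * G, ?_⟩
  rw [sub_eq_iff_eq_add'.1 hG]
  congr 1
  have h : ∀ j : m, (Matrix.single x j (1 : ℂ) * G)ᴴ * (Matrix.single x j (1 : ℂ) * G)
      = Gᴴ * (Matrix.single j j (1 : ℂ) * G) := fun j => by
    rw [conjTranspose_mul, conjTranspose_single, star_one, Matrix.mul_assoc,
      ← Matrix.mul_assoc _ _ G, single_mul_single_same, one_mul]
  simp only [h]
  rw [← Matrix.mul_sum, ← Matrix.sum_mul, sum_single_one, Matrix.one_mul]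

/-! ### Fidelity with a maximally entangled state -/

theorem cfc_sqrt_of_mul_self {m : Type*} [Fintype m] [DecidableEq m] {A B : Matrix m m ℂ}
    (hB : B.PosSemidef) (h : B * B = A) : cfc Real.sqrt A = B := by
  open scoped MatrixOrder in
  have hA : (0 : Matrix m m ℂ) ≤ A := by
    rw [← h]
    nth_rewrite 1 [← hB.isHermitian.eq]
    exact (posSemidef_conjTranspose_mul_self B).nonneg
  rw [← cfcₙ_eq_cfc, ← CFC.sqrt_eq_real_sqrt A hA]
  exact CFC.sqrt_unique h hB.nonneg

theorem exists_sqrt {m : Type*} [Fintype m] [DecidableEq m] {A : Matrix m m ℂ}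
    (hA : A.PosSemidef) : ∃ B : Matrix m m ℂ, B.PosSemidef ∧ B * B = A := by
  open scoped MatrixOrder in
  exact ⟨CFC.sqrt A, nonneg_iff_posSemidef.1 (CFC.sqrt_nonneg A),
    CFC.sqrt_mul_sqrt_self A hA.nonneg⟩

/-- The fidelity with a pure state is an expectation value, in particular it is linear in the other
argument. -/
theorem fidelity_vecMulVec {m : Type*} [Fintype m] [DecidableEq m] {ρ : Matrix m m ℂ}
    (hρ : ρ.PosSemidef) {ψ : m → ℂ} (hψ : star ψ ⬝ᵥ ψ = 1) :
    fidelity ρ (vecMulVec ψ (star ψ)) = (star ψ ⬝ᵥ ρ *ᵥ ψ).re := by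
  have hP : (vecMulVec ψ (star ψ)).PosSemidef := posSemidef_vecMulVec_self_star ψ
  have hPP : vecMulVec ψ (star ψ) * vecMulVec ψ (star ψ) = vecMulVec ψ (star ψ) := by
    rw [vecMulVec_mul_vecMulVec, hψ, one_smul]
  obtain ⟨B, hB, hBB⟩ := exists_sqrt hρ
  have hc : 0 ≤ star ψ ⬝ᵥ ρ *ᵥ ψ := hρ.dotProduct_mulVec_nonneg ψ
  obtain ⟨hc0, hc1⟩ := Complex.le_def.1 hc
  set c : ℝ := (star ψ ⬝ᵥ ρ *ᵥ ψ).re with hcdef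
  have hc' : star ψ ⬝ᵥ ρ *ᵥ ψ = (c : ℂ) := Complex.ext rfl (by simpa using hc1.symm)
  have hX : (B * vecMulVec ψ (star ψ))ᴴ * (B * vecMulVec ψ (star ψ))
      = (c : ℂ) • vecMulVec ψ (star ψ) := by
    rw [conjTranspose_mul, hP.isHermitian.eq, hB.isHermitian.eq, Matrix.mul_assoc,
      ← Matrix.mul_assoc B, hBB, mul_vecMulVec, vecMulVec_mul_vecMulVec, hc', vecMulVec_smul]
  have hs : cfc Real.sqrt ((c : ℂ) • vecMulVec ψ (star ψ))
      = (√c : ℂ) • vecMulVec ψ (star ψ) := by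
    refine cfc_sqrt_of_mul_self (hP.smul (by exact_mod_cast Real.sqrt_nonneg c)) ?_
    rw [smul_mul_smul_comm, hPP, ← Complex.ofReal_mul, Real.mul_self_sqrt hc0]
  have htr : (vecMulVec ψ (star ψ)).trace = 1 := by
    rw [trace_vecMulVec, dotProduct_comm, hψ]
  rw [fidelity, traceNorm, cfc_sqrt_of_mul_self hP hPP, cfc_sqrt_of_mul_self hB hBB, hX, hs,
    trace_smul, htr, smul_eq_mul, mul_one, Complex.ofReal_re, Real.sq_sqrt hc0]

/-- The expectation value of a state in a unit vector is at most its trace. -/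
theorem re_dotProduct_mulVec_le_trace {m : Type*} [Fintype m] [DecidableEq m] {ρ : Matrix m m ℂ}
    (hρ : ρ.PosSemidef) {ψ : m → ℂ} (hψ : star ψ ⬝ᵥ ψ = 1) :
    (star ψ ⬝ᵥ ρ *ᵥ ψ).re ≤ ρ.trace.re := by
  have hQ : ((1 : Matrix m m ℂ) - vecMulVec ψ (star ψ)).PosSemidef := by
    have hH : ((1 : Matrix m m ℂ) - vecMulVec ψ (star ψ))ᴴ = 1 - vecMulVec ψ (star ψ) := by
      rw [conjTranspose_sub, conjTranspose_one, (posSemidef_vecMulVec_self_star ψ).isHermitian.eq]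
    have hPP : vecMulVec ψ (star ψ) * vecMulVec ψ (star ψ) = vecMulVec ψ (star ψ) := by
      rw [vecMulVec_mul_vecMulVec, hψ, one_smul]
    have := posSemidef_conjTranspose_mul_self ((1 : Matrix m m ℂ) - vecMulVec ψ (star ψ))
    rw [hH] at this
    convert this using 1
    rw [Matrix.mul_sub, Matrix.sub_mul, Matrix.sub_mul, hPP]
    simp
  obtain ⟨B, hB, hBB⟩ := exists_sqrt hρ
  have h := (Complex.le_def.1 (hQ.conjTranspose_mul_mul_same B).trace_nonneg).1
  rw [hB.isHermitian.eq, trace_mul_comm, ← Matrix.mul_assoc, hBB, Matrix.mul_sub, trace_sub,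
    Matrix.mul_one, mul_vecMulVec, trace_vecMulVec, dotProduct_comm] at h
  simpa using h

/-- The unit vector `k^{-1/2} ∑ m, |m m⟩`. -/
def maxEntVec (k : ℕ) : Fin k × Fin k → ℂ := fun x => if x.1 = x.2 then ((√k)⁻¹ : ℝ) else 0

theorem inv_sqrt_mul_self (k : ℕ) : (((√k)⁻¹ : ℝ) : ℂ) * ((√k)⁻¹ : ℝ) = (k : ℂ)⁻¹ := by
  rw [← Complex.ofReal_mul, ← mul_inv, Real.mul_self_sqrt (Nat.cast_nonneg k)]
  simp

theorem star_maxEntVec_dotProduct_self {k : ℕ} (hk : 1 ≤ k) :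
    star (maxEntVec k) ⬝ᵥ maxEntVec k = 1 := by
  have hk' : (k : ℂ) ≠ 0 := by exact_mod_cast (by omega : k ≠ 0)
  simp only [dotProduct, Fintype.sum_prod_type, maxEntVec, Pi.star_apply, apply_ite star, star_zero,
    Complex.star_def, Complex.conj_ofReal, ite_mul, zero_mul, mul_ite, mul_zero]
  simp only [sum_ite_eq, mem_univ, if_true, inv_sqrt_mul_self]
  simp [hk']

theorem isMaxEntangled_maxEntVec {k : ℕ} (hk : 1 ≤ k) :
    IsMaxEntangled (vecMulVec (maxEntVec k) (star (maxEntVec k))) := by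
  refine ⟨⟨posSemidef_vecMulVec_self_star _, ?_⟩, ⟨_, rfl⟩, ?_, ?_⟩
  · rw [trace_vecMulVec, dotProduct_comm, star_maxEntVec_dotProduct_self hk]
  all_goals
    ext i j
    simp only [traceSnd, traceFst, of_apply, vecMulVec_apply, maxEntVec, Pi.star_apply,
      apply_ite star, star_zero, Complex.star_def, Complex.conj_ofReal, ite_mul, zero_mul, mul_ite,
      mul_zero, Matrix.smul_apply, Matrix.one_apply, smul_eq_mul, mul_one]
    by_cases h : i = j
    · subst h
      simp [← inv_sqrt_mul_self]
    · have h' : j ≠ i := fun e => h e.symm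
      simp [h, h']

/-- The amplitude of `|Φ⟩` in `(K ⊗ L) v`. -/
theorem maxEntVec_dotProduct_kronecker {A B : Type*} [Fintype A] [Fintype B] {k : ℕ}
    (K : Matrix (Fin k) A ℂ) (L : Matrix (Fin k) B ℂ) (v : A × B → ℂ) :
    star (maxEntVec k) ⬝ᵥ (K ⊗ₖ L) *ᵥ v
      = ((√k)⁻¹ : ℝ) * ∑ m, ∑ b, L m b * ∑ a, K m a * v (a, b) := by
  simp only [dotProduct, Fintype.sum_prod_type, maxEntVec, Pi.star_apply, apply_ite star, star_zero,
    Complex.star_def, Complex.conj_ofReal, ite_mul, zero_mul, mulVec, kroneckerMap_apply]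
  simp only [sum_ite_eq, mem_univ, if_true, ← mul_sum]
  congr 1
  refine sum_congr rfl fun m _ => ?_
  rw [sum_comm]
  refine sum_congr rfl fun b _ => ?_
  rw [mul_sum]
  exact sum_congr rfl fun a _ => by ring

/-- The expectation value of a Kraus map in terms of amplitudes. -/
theorem re_dotProduct_krausMap {m n ι E : Type*} [Fintype m] [Fintype n] [Fintype ι] [Fintype E]
    (K : ι → Matrix n m ℂ) (v : E → m → ℂ) (φ : n → ℂ) :
    (star φ ⬝ᵥ krausMap K (∑ e, vecMulVec (v e) (star (v e))) *ᵥ φ).re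
      = ∑ i, ∑ e, ‖star φ ⬝ᵥ K i *ᵥ v e‖ ^ 2 := by
  simp only [krausMap_apply, Matrix.mul_sum, Matrix.sum_mul, sum_mulVec, dotProduct_sum,
    Complex.re_sum]
  refine sum_congr rfl fun i _ => sum_congr rfl fun e _ => ?_
  rw [mul_vecMulVec, vecMulVec_mul, vecMulVec_mulVec, ← star_mulVec, dotProduct_smul]
  have : star (K i *ᵥ v e) ⬝ᵥ φ = star (star φ ⬝ᵥ K i *ᵥ v e) := by
    rw [star_dotProduct]
  rw [this, op_smul_eq_smul, smul_eq_mul, mul_comm, Complex.star_def,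
    Complex.mul_conj, Complex.ofReal_re, Complex.normSq_eq_norm_sq]

/-! ### From Kraus operators to a protocol -/

/-- Alice measures with Kraus operators `K w` and reports `w`; Bob then applies the contraction
with blocks `V w f`, completed to a channel. The amplitudes on the completion are dropped in the
estimate. -/
theorem exists_oneWayLOCC {A B E F Ω : Type*} [Fintype A] [DecidableEq A] [Fintype B]
    [DecidableEq B] [Fintype E] [Fintype F] [Fintype Ω] {k : ℕ} (hk : 1 ≤ k)
    (K : Ω → Matrix (Fin k) A ℂ) (hK : ∑ w, (K w)ᴴ * K w = 1)
    (V : Ω → F → Matrix (Fin k) B ℂ) (hV : ∀ w, (1 - ∑ f, (V w f)ᴴ * V w f).PosSemidef) :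
    ∃ T : Matrix (A × B) (A × B) ℂ →ₗ[ℂ] Matrix (Fin k × Fin k) (Fin k × Fin k) ℂ,
      IsOneWayLOCC T ∧ (∀ X, X.PosSemidef → (T X).PosSemidef) ∧ IsTracePreserving T ∧
      ∀ v : E → A × B → ℂ,
        ∑ w, ∑ e, ∑ f, ‖(((√k)⁻¹ : ℝ) : ℂ) * ∑ m, ∑ b, V w f m b * ∑ a, K w m a * v e (a, b)‖ ^ 2
          ≤ (star (maxEntVec k) ⬝ᵥ
              T (∑ e, vecMulVec (v e) (star (v e))) *ᵥ maxEntVec k).re := by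
  have : Nonempty (Fin k) := ⟨⟨0, hk⟩⟩
  choose L hL using fun w => exists_kraus_completion (V w) (hV w)
  let W : Ω → F ⊕ B → Matrix (Fin k) B ℂ := fun w => Sum.elim (V w) (L w)
  have hW : ∀ w, ∑ f, (W w f)ᴴ * W w f = 1 := fun w => by
    rw [Fintype.sum_sum_type]
    exact hL w
  let enum := (Fintype.equivFin Ω).symm
  have hT : ∑ j, tensorMap (krausMap fun _ : Unit => K (enum j)) (krausMap (W (enum j)))
      = krausMap fun x : Ω × (F ⊕ B) => K x.1 ⊗ₖ W x.1 x.2 := by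
    ext1 X
    simp only [tensorMap_krausMap, LinearMap.sum_apply]
    rw [Equiv.sum_comp enum fun w => krausMap (fun x : Unit × (F ⊕ B) => K w ⊗ₖ W w x.2) X]
    simp only [krausMap_apply, Fintype.sum_prod_type, univ_unique, sum_singleton]
  refine ⟨krausMap fun x : Ω × (F ⊕ B) => K x.1 ⊗ₖ W x.1 x.2,
    ⟨_, fun j => krausMap fun _ : Unit => K (enum j), fun j => krausMap (W (enum j)),
      isInstrument_krausMap K hK enum, fun j => ⟨krausMap_isCP _, fun X => ?_⟩, hT.symm⟩,
    fun X hX => krausMap_posSemidef _ hX, fun X => ?_, fun v => ?_⟩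
  · rw [trace_krausMap, hW, Matrix.one_mul]
  · rw [trace_krausMap]
    simp only [Fintype.sum_prod_type, conjTranspose_kronecker, ← mul_kronecker_mul]
    have h : ∀ w, ∑ f, ((K w)ᴴ * K w) ⊗ₖ ((W w f)ᴴ * W w f) = ((K w)ᴴ * K w) ⊗ₖ 1 := fun w => by
      rw [← hW w]
      ext x y
      simp only [kroneckerMap_apply, Matrix.sum_apply, mul_sum]
    have h' : ∑ w, ((K w)ᴴ * K w) ⊗ₖ (1 : Matrix B B ℂ) = 1 := by
      rw [← one_kronecker_one, ← hK]
      ext x y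
      simp only [kroneckerMap_apply, Matrix.sum_apply, sum_mul]
    simp only [h, h', Matrix.one_mul]
  · rw [re_dotProduct_krausMap, Fintype.sum_prod_type]
    refine sum_le_sum fun w _ => ?_
    rw [Fintype.sum_sum_type, sum_comm]
    refine le_trans (le_of_eq ?_) (le_add_of_nonneg_right
      (sum_nonneg fun _ _ => sum_nonneg fun _ _ => sq_nonneg _))
    refine sum_congr rfl fun f _ => sum_congr rfl fun e _ => ?_
    rw [maxEntVec_dotProduct_kronecker]
    rfl

/-! ### Random phases -/

/-- The coordinate `x` of a family `w` of independent uniform cube roots of unity. Third roots are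
used because the products `phase w x * star (phase w y)` for `x ≠ y` are then pairwise orthogonal;
signs would identify `(x, y)` with `(y, x)`. -/
def phase {X : Type*} (w : X → ZMod 3) (x : X) : ℂ := ZMod.stdAddChar (w x)

theorem phase_mul_star_phase {X : Type*} (w : X → ZMod 3) (x y : X) :
    phase w x * star (phase w y) = ZMod.stdAddChar (w x - w y) := by
  rw [phase, phase, Complex.star_def, ← AddChar.map_neg_eq_conj, ← AddChar.map_add_eq_mul,
    sub_eq_add_neg]

theorem phase_mul_star_phase_self {X : Type*} (w : X → ZMod 3) (x : X) :
    phase w x * star (phase w x) = 1 := by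
  rw [phase_mul_star_phase, sub_self, AddChar.map_zero_eq_one]

/-- A nontrivial character of the group of exponents has mean zero. -/
theorem sum_stdAddChar_hom_eq_zero {G : Type*} [AddCommGroup G] [Fintype G] (L : G →+ ZMod 3)
    (t : G) (ht : L t ≠ 0) : ∑ w, (ZMod.stdAddChar (L w) : ℂ) = 0 := by
  have h : (ZMod.stdAddChar (N := 3)).compAddMonoidHom L ≠ 1 := by
    intro h
    refine ht (ZMod.injective_stdAddChar ?_)
    rw [AddChar.map_zero_eq_one]
    exact DFunLike.congr_fun h t
  exact AddChar.sum_eq_zero_of_ne_one h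

theorem sum_phase_mul_star_phase {X : Type*} [Fintype X] [DecidableEq X] (x y : X) :
    ∑ w : X → ZMod 3, phase w x * star (phase w y)
      = if x = y then (Fintype.card (X → ZMod 3) : ℂ) else 0 := by
  split_ifs with h
  · subst h
    simp only [phase_mul_star_phase_self]
    simp
  · simp only [phase_mul_star_phase]
    refine sum_stdAddChar_hom_eq_zero
      (Pi.evalAddMonoidHom (fun _ => ZMod 3) x - Pi.evalAddMonoidHom (fun _ => ZMod 3) y)
      (Pi.single x 1) ?_
    simp [Ne.symm h]

/-- Orthogonality of the off-diagonal products of phases. -/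
theorem sum_phase_four {X : Type*} [Fintype X] [DecidableEq X] {x y z u : X} (hxy : x ≠ y)
    (hzu : z ≠ u) : ∑ w : X → ZMod 3,
      phase w x * star (phase w y) * star (phase w z * star (phase w u))
      = if (x, y) = (z, u) then (Fintype.card (X → ZMod 3) : ℂ) else 0 := by
  split_ifs with h
  · obtain ⟨rfl, rfl⟩ := Prod.mk.inj h
    have : ∀ w : X → ZMod 3,
        phase w x * star (phase w y) * star (phase w x * star (phase w y)) = 1 := fun w => by
      rw [star_mul', star_star, mul_mul_mul_comm, phase_mul_star_phase_self, one_mul,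
        mul_comm, phase_mul_star_phase_self]
    simp only [this]
    simp
  · have e : ∀ w : X → ZMod 3, phase w x * star (phase w y) * star (phase w z * star (phase w u))
        = ZMod.stdAddChar ((w x - w y) - (w z - w u)) := fun w => by
      rw [phase_mul_star_phase, phase_mul_star_phase, Complex.star_def, ← AddChar.map_neg_eq_conj,
        ← AddChar.map_add_eq_mul, sub_eq_add_neg (w x - w y)]
    simp only [e]
    let p : X → (X → ZMod 3) →+ ZMod 3 := fun x => Pi.evalAddMonoidHom (fun _ => ZMod 3) x
    by_cases hz : x = z
    · subst hz
      have hu : y ≠ u := fun hu => h (by rw [hu])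
      refine sum_stdAddChar_hom_eq_zero ((p x - p y) - (p x - p u)) (Pi.single y 1) ?_
      simp [p, hu.symm]
    · refine sum_stdAddChar_hom_eq_zero ((p x - p y) - (p z - p u)) (Pi.single x 1) ?_
      by_cases hu : u = x
      · subst hu
        simp only [AddMonoidHom.sub_apply, Pi.evalAddMonoidHom_apply, p, Pi.single_eq_same,
          Pi.single_eq_of_ne (Ne.symm hxy), Pi.single_eq_of_ne (Ne.symm hz)]
        decide
      · simp [p, Ne.symm hxy, Ne.symm hz, hu]

/-- Parseval's inequality for a quadratic form in the phases: its variance is at most the sum of the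
squares of its coefficients. -/
theorem sum_norm_sq_quadratic_phase_sub_le {X : Type*} [Fintype X] [DecidableEq X]
    (c : X → X → ℂ) :
    ∑ w : X → ZMod 3, ‖∑ x, ∑ y, c x y * (phase w x * star (phase w y)) - ∑ x, c x x‖ ^ 2
      ≤ Fintype.card (X → ZMod 3) * ∑ x, ∑ y, ‖c x y‖ ^ 2 := by
  let s : Finset (X × X) := univ.filter fun p => p.1 ≠ p.2
  have h1 : ∀ w : X → ZMod 3,
      ∑ x, ∑ y, c x y * (phase w x * star (phase w y)) - ∑ x, c x x
        = ∑ p ∈ s, c p.1 p.2 * (phase w p.1 * star (phase w p.2)) := fun w => by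
    rw [sub_eq_iff_eq_add, ← Fintype.sum_prod_type',
      ← sum_filter_add_sum_filter_not univ (fun p : X × X => p.1 ≠ p.2)]
    congr 1
    simp only [ne_eq, not_not]
    rw [sum_filter, Fintype.sum_prod_type]
    refine sum_congr rfl fun x _ => ?_
    simp only [sum_ite_eq, mem_univ, if_true, phase_mul_star_phase_self, mul_one]
  have h2 : ∑ w : X → ZMod 3, ‖∑ x, ∑ y, c x y * (phase w x * star (phase w y)) - ∑ x, c x x‖ ^ 2
      = Fintype.card (X → ZMod 3) * ∑ p ∈ s, ‖c p.1 p.2‖ ^ 2 := by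
    have hn : ∀ z : ℂ, ((‖z‖ ^ 2 : ℝ) : ℂ) = z * star z := fun z => by
      rw [Complex.star_def, Complex.mul_conj, Complex.normSq_eq_norm_sq]
    apply Complex.ofReal_injective
    rw [Complex.ofReal_sum, Complex.ofReal_mul, Complex.ofReal_sum]
    simp only [hn, h1, star_sum, sum_mul_sum]
    rw [sum_comm, mul_sum]
    refine sum_congr rfl fun p hp => ?_
    rw [sum_comm, sum_eq_single_of_mem p hp]
    · have := sum_phase_four (mem_filter.1 hp).2 (mem_filter.1 hp).2
      rw [if_pos rfl] at this
      rw [Complex.ofReal_natCast, ← this, sum_mul]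
      refine sum_congr rfl fun w _ => ?_
      rw [star_mul']
      ring
    · intro q hq hqp
      have := sum_phase_four (mem_filter.1 hp).2 (mem_filter.1 hq).2
      rw [if_neg (fun e => hqp e.symm)] at this
      rw [← mul_zero (c p.1 p.2 * star (c q.1 q.2)), ← this, mul_sum]
      refine sum_congr rfl fun w _ => ?_
      rw [star_mul' (c q.1 q.2)]
      ring
  rw [h2, ← Fintype.sum_prod_type' (f := fun x y => ‖c x y‖ ^ 2)]
  gcongr
  exact subset_univ _

/-! ### Second moments of the randomly encoded state -/

/-- The random encoding applied to a family of bipartite vectors. The vectors are stored as matrices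
with rows indexed by `B` and columns by `A`; the label `e` plays the role of a purifying
environment, and the result is the operator from `B` to (code space) ⊗ (environment) representing
the encoded pure state. The normalisation makes the marginal on (code space) ⊗ (environment) have
the same trace as the original state on average over `w`. -/
def encode {A B E : Type*} [Fintype A] {k : ℕ} (w : Fin k × A → ZMod 3) (ψ : E → Matrix B A ℂ) :
    Matrix (Fin k × E) B ℂ :=
  Matrix.of fun x b => (((√k)⁻¹ : ℝ) : ℂ) * ∑ a, phase w (x.1, a) * ψ x.2 b a

/-- The matrix `tr_B |ψ e⟩⟨ψ e'|` on `A`. -/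
def crossMarginal {A B E : Type*} [Fintype B] (ψ : E → Matrix B A ℂ) (e e' : E) : Matrix A A ℂ :=
  Matrix.of fun a a' => ∑ b, ψ e b a * star (ψ e' b a')

/-- The marginal of the purification on the environment: the Gram matrix of the vectors `ψ e`. -/
def envMarginal {A B E : Type*} [Fintype A] [Fintype B] (ψ : E → Matrix B A ℂ) : Matrix E E ℂ :=
  Matrix.of fun e e' => ∑ a, crossMarginal ψ e e' a a

/-- The maximally mixed state on the code space times the marginal on the environment. -/
def decoupled {A B E : Type*} [Fintype A] [Fintype B] (k : ℕ) (ψ : E → Matrix B A ℂ) :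
    Matrix (Fin k × E) (Fin k × E) ℂ :=
  (k : ℂ)⁻¹ • ((1 : Matrix (Fin k) (Fin k) ℂ) ⊗ₖ envMarginal ψ)

/-- The total squared norm of a family of vectors. -/
def totalNormSq {A B E : Type*} [Fintype A] [Fintype B] [Fintype E] (ψ : E → Matrix B A ℂ) : ℝ :=
  ∑ e, ∑ b, ∑ a, ‖ψ e b a‖ ^ 2

theorem ofReal_norm_sq (z : ℂ) : ((‖z‖ ^ 2 : ℝ) : ℂ) = z * star z := by
  rw [Complex.star_def, Complex.mul_conj, Complex.normSq_eq_norm_sq]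

theorem trace_mul_conjTranspose_re {m n : Type*} [Fintype m] [Fintype n] (X : Matrix m n ℂ) :
    (X * Xᴴ).trace.re = ∑ i, ∑ j, ‖X i j‖ ^ 2 := by
  have : (X * Xᴴ).trace = ((∑ i, ∑ j, ‖X i j‖ ^ 2 : ℝ) : ℂ) := by
    simp only [Complex.ofReal_sum, ofReal_norm_sq, trace, diag_apply, Matrix.mul_apply,
      conjTranspose_apply]
  rw [this, Complex.ofReal_re]

/-- The Cauchy-Schwarz inequality. -/
theorem norm_sum_star_mul_sq_le {ι : Type*} [Fintype ι] (f g : ι → ℂ) :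
    ‖∑ i, star (f i) * g i‖ ^ 2 ≤ (∑ i, ‖f i‖ ^ 2) * ∑ i, ‖g i‖ ^ 2 := by
  calc ‖∑ i, star (f i) * g i‖ ^ 2 ≤ (∑ i, ‖f i‖ * ‖g i‖) ^ 2 := by
        gcongr
        refine (norm_sum_le _ _).trans_eq (sum_congr rfl fun i _ => ?_)
        rw [norm_mul, norm_star]
    _ ≤ _ := sum_mul_sq_le_sq_mul_sq _ _ _

theorem trace_conjTranspose_mul {m n : Type*} [Fintype m] [Fintype n] (X Y : Matrix m n ℂ) :
    (Xᴴ * Y).trace = ∑ p : m × n, star (X p.1 p.2) * Y p.1 p.2 := by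
  rw [Fintype.sum_prod_type, sum_comm]
  simp only [trace, diag_apply, Matrix.mul_apply, conjTranspose_apply]

theorem norm_trace_conjTranspose_mul_sq_le {m n : Type*} [Fintype m] [Fintype n]
    (X Y : Matrix m n ℂ) :
    ‖(Xᴴ * Y).trace‖ ^ 2 ≤ (X * Xᴴ).trace.re * (Y * Yᴴ).trace.re := by
  rw [trace_conjTranspose_mul, trace_mul_conjTranspose_re, trace_mul_conjTranspose_re,
    ← Fintype.sum_prod_type' (f := fun i j => ‖X i j‖ ^ 2),
    ← Fintype.sum_prod_type' (f := fun i j => ‖Y i j‖ ^ 2)]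
  exact norm_sum_star_mul_sq_le _ _

section Moments

variable {A B E : Type*} [Fintype A] [Fintype B] {k : ℕ}

theorem envMarginal_posSemidef [Finite E] (ψ : E → Matrix B A ℂ) : (envMarginal ψ).PosSemidef := by
  have : envMarginal ψ = (Matrix.of fun (e : E) (p : A × B) => ψ e p.2 p.1)
      * (Matrix.of fun (e : E) (p : A × B) => ψ e p.2 p.1)ᴴ := by
    ext e e'
    simp only [envMarginal, crossMarginal, of_apply, Matrix.mul_apply, conjTranspose_apply,
      Fintype.sum_prod_type]
  rw [this]
  exact posSemidef_self_mul_conjTranspose _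

theorem trace_envMarginal [Fintype E] (ψ : E → Matrix B A ℂ) :
    (envMarginal ψ).trace = (totalNormSq ψ : ℂ) := by
  simp only [totalNormSq, Complex.ofReal_sum, ofReal_norm_sq, trace, diag_apply, envMarginal,
    crossMarginal, of_apply]
  exact sum_congr rfl fun e _ => sum_comm

theorem decoupled_posSemidef [Finite E] (ψ : E → Matrix B A ℂ) : (decoupled k ψ).PosSemidef :=
  (PosSemidef.one.kronecker (envMarginal_posSemidef ψ)).smul (by
    rw [← Complex.ofReal_natCast, ← Complex.ofReal_inv]
    exact_mod_cast inv_nonneg.2 (Nat.cast_nonneg (α := ℝ) k))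

theorem trace_decoupled [Fintype E] (hk : 1 ≤ k) (ψ : E → Matrix B A ℂ) :
    (decoupled k ψ).trace = (totalNormSq ψ : ℂ) := by
  have hk' : (k : ℂ) ≠ 0 := by exact_mod_cast (by omega : k ≠ 0)
  rw [decoupled, trace_smul, trace_kronecker, trace_envMarginal, trace_one, Fintype.card_fin,
    smul_eq_mul, inv_mul_cancel_left₀ hk']

/-- Entries of the encoded marginal are quadratic in the phases. -/
theorem encode_mul_conjTranspose_apply (w : Fin k × A → ZMod 3) (ψ : E → Matrix B A ℂ)
    (x y : Fin k × E) :
    (encode w ψ * (encode w ψ)ᴴ) x y = (k : ℂ)⁻¹ * ∑ a, ∑ a',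
      crossMarginal ψ x.2 y.2 a a' * (phase w (x.1, a) * star (phase w (y.1, a'))) := by
  simp only [Matrix.mul_apply, conjTranspose_apply, encode, of_apply, star_mul', star_sum,
    Complex.star_def, Complex.conj_ofReal, crossMarginal, ← inv_sqrt_mul_self]
  have : ∀ b, (((√k)⁻¹ : ℝ) : ℂ) * (∑ a, phase w (x.1, a) * ψ x.2 b a) *
      ((((√k)⁻¹ : ℝ) : ℂ) * ∑ a, (starRingEnd ℂ) (phase w (y.1, a)) * (starRingEnd ℂ) (ψ y.2 b a))
      = (((√k)⁻¹ : ℝ) : ℂ) * (((√k)⁻¹ : ℝ) : ℂ) * ∑ a, ∑ a', ψ x.2 b a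
        * (starRingEnd ℂ) (ψ y.2 b a')
        * (phase w (x.1, a) * (starRingEnd ℂ) (phase w (y.1, a'))) := fun b => by
    rw [mul_mul_mul_comm, sum_mul_sum]
    congr 1
    exact sum_congr rfl fun a _ => sum_congr rfl fun a' _ => by ring
  simp only [this, ← mul_sum]
  congr 1
  rw [sum_comm]
  refine sum_congr rfl fun a _ => ?_
  rw [sum_comm]
  exact sum_congr rfl fun a' _ => by rw [sum_mul]

/-- On average over the phases the encoded state is decoupled from the environment. -/
theorem sum_encode_mul_conjTranspose [DecidableEq A] (ψ : E → Matrix B A ℂ) :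
    ∑ w : Fin k × A → ZMod 3, encode w ψ * (encode w ψ)ᴴ
      = (Fintype.card (Fin k × A → ZMod 3) : ℂ) • decoupled k ψ := by
  ext x y
  rw [Matrix.sum_apply]
  simp only [encode_mul_conjTranspose_apply, ← mul_sum]
  rw [sum_comm]
  have : ∀ a, ∑ w : Fin k × A → ZMod 3, ∑ a', crossMarginal ψ x.2 y.2 a a'
      * (phase w (x.1, a) * star (phase w (y.1, a')))
      = if x.1 = y.1 then Fintype.card (Fin k × A → ZMod 3) * crossMarginal ψ x.2 y.2 a a
        else 0 := fun a => by
    rw [sum_comm]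
    simp only [← mul_sum, sum_phase_mul_star_phase, Prod.mk.injEq]
    split_ifs with h
    · simp [h, mul_comm]
    · simp [h]
  simp only [this, decoupled, Matrix.smul_apply, kroneckerMap_apply, smul_eq_mul, Matrix.one_apply,
    envMarginal, of_apply]
  split_ifs with h
  · rw [← mul_sum]
    ring
  · simp

/-- The variance of the encoded state around its mean. -/
theorem sum_norm_encode_sub_decoupled_sq_le [DecidableEq A] (ψ : E → Matrix B A ℂ)
    (x y : Fin k × E) :
    ∑ w : Fin k × A → ZMod 3,
        ‖(encode w ψ * (encode w ψ)ᴴ - decoupled k ψ) x y‖ ^ 2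
      ≤ Fintype.card (Fin k × A → ZMod 3)
        * (((k : ℝ)⁻¹) ^ 2 * ∑ a, ∑ a', ‖crossMarginal ψ x.2 y.2 a a'‖ ^ 2) := by
  let c : Fin k × A → Fin k × A → ℂ := fun p q =>
    if p.1 = x.1 then if q.1 = y.1 then crossMarginal ψ x.2 y.2 p.2 q.2 else 0 else 0
  have hsum : ∀ f : Fin k × A → Fin k × A → ℂ,
      ∑ p, ∑ q, c p q * f p q
        = ∑ a, ∑ a', crossMarginal ψ x.2 y.2 a a' * f (x.1, a) (y.1, a') := fun f => by
    simp only [c, Fintype.sum_prod_type, ite_mul, zero_mul]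
    rw [Fintype.sum_eq_single x.1 fun m hm => by simp [hm]]
    refine sum_congr rfl fun a _ => ?_
    simp only [if_true]
    rw [Fintype.sum_eq_single y.1 fun m hm => by simp [hm]]
    simp
  have hdiag : ∑ p, c p p = (if x.1 = y.1 then envMarginal ψ x.2 y.2 else 0) := by
    simp only [c, Fintype.sum_prod_type]
    rw [Fintype.sum_eq_single x.1 fun m hm => by simp [hm]]
    by_cases h : x.1 = y.1
    · simp [h, envMarginal]
    · simp [h]
  have hnorm : ∑ p, ∑ q, ‖c p q‖ ^ 2 = ∑ a, ∑ a', ‖crossMarginal ψ x.2 y.2 a a'‖ ^ 2 := by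
    simp only [c, Fintype.sum_prod_type]
    rw [Fintype.sum_eq_single x.1 fun m hm => by simp [hm]]
    refine sum_congr rfl fun a _ => ?_
    simp only [if_true]
    rw [Fintype.sum_eq_single y.1 fun m hm => by simp [hm]]
    simp
  have hentry : ∀ w : Fin k × A → ZMod 3, (encode w ψ * (encode w ψ)ᴴ - decoupled k ψ) x y
      = (k : ℂ)⁻¹ * (∑ p, ∑ q, c p q * (phase w p * star (phase w q)) - ∑ p, c p p) := fun w => by
    rw [Matrix.sub_apply, encode_mul_conjTranspose_apply, hsum, hdiag, mul_sub]
    congr 1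
    simp [decoupled, Matrix.one_apply]
  simp only [hentry, norm_mul, mul_pow, ← mul_sum]
  rw [norm_inv, Complex.norm_natCast, mul_left_comm, ← hnorm]
  gcongr
  exact sum_norm_sq_quadratic_phase_sub_le c

theorem sum_totalNormSq_encode [DecidableEq A] [Fintype E] (hk : 1 ≤ k) (ψ : E → Matrix B A ℂ) :
    ∑ w : Fin k × A → ZMod 3, (encode w ψ * (encode w ψ)ᴴ).trace.re
      = Fintype.card (Fin k × A → ZMod 3) * totalNormSq ψ := by
  rw [← Complex.re_sum, ← trace_sum, sum_encode_mul_conjTranspose, trace_smul, trace_decoupled hk,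
    smul_eq_mul, ← Complex.ofReal_natCast, ← Complex.ofReal_mul, Complex.ofReal_re]

/-- The `χ²`-type second moment which controls the decoder. The positive weights `d` regularise the
marginal of the environment, which need not be invertible. -/
theorem sum_trace_encode_inv_le [DecidableEq A] [Fintype E] [DecidableEq E] (hk : 1 ≤ k)
    (ψ : E → Matrix B A ℂ) (d : E → ℝ) (hd : ∀ e, 0 < d e) :
    ∑ w : Fin k × A → ZMod 3,
      ((encode w ψ * (encode w ψ)ᴴ)
        * (decoupled k ψ + diagonal fun x : Fin k × E => (((k : ℝ)⁻¹ * d x.2 : ℝ) : ℂ))⁻¹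
        * (encode w ψ * (encode w ψ)ᴴ)).trace.re
      ≤ Fintype.card (Fin k × A → ZMod 3) * (totalNormSq ψ
        + k * ∑ e, ∑ e', (d e')⁻¹ * ∑ a, ∑ a', ‖crossMarginal ψ e e' a a'‖ ^ 2) := by
  have hk0 : (0 : ℝ) < k := by exact_mod_cast hk
  have hD : (diagonal fun x : Fin k × E => (((k : ℝ)⁻¹ * d x.2 : ℝ) : ℂ)).PosDef :=
    PosDef.diagonal fun x => by exact_mod_cast mul_pos (inv_pos.2 hk0) (hd x.2)
  have hDinv : (diagonal fun x : Fin k × E => (((k : ℝ)⁻¹ * d x.2 : ℝ) : ℂ))⁻¹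
      = diagonal fun x : Fin k × E => ((k * (d x.2)⁻¹ : ℝ) : ℂ) := by
    refine inv_eq_left_inv ?_
    rw [diagonal_mul_diagonal, ← diagonal_one]
    congr 1
    ext x
    rw [← Complex.ofReal_mul, ← Complex.ofReal_one]
    congr 1
    have := (hd x.2).ne'
    field_simp
  have hP := decoupled_posSemidef (k := k) ψ
  have hmain := (Complex.le_def.1 (posSemidef_sub_mul_inv_add_mul hP hD).trace_nonneg).1
  have hinv := posSemidef_inv_sub_inv_add hP hD
  rw [hDinv] at hinv
  have hmean := sum_encode_mul_conjTranspose (k := k) ψ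
  have hvar := sum_norm_encode_sub_decoupled_sq_le (k := k) ψ
  have htr := trace_decoupled hk ψ
  set P := decoupled k ψ with hPdef
  set I := (P + diagonal fun x : Fin k × E => (((k : ℝ)⁻¹ * d x.2 : ℝ) : ℂ))⁻¹ with hI
  set n : ℝ := (Fintype.card (Fin k × A → ZMod 3) : ℝ) with hn
  rw [trace_sub, htr, Complex.sub_re, Complex.ofReal_re, Complex.zero_re] at hmain
  let σ : (Fin k × A → ZMod 3) → Matrix (Fin k × E) (Fin k × E) ℂ := fun w =>
    encode w ψ * (encode w ψ)ᴴ
  have hσ : ∀ w, (σ w)ᴴ = σ w := fun w => (posSemidef_self_mul_conjTranspose _).isHermitian.eq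
  -- The cross terms vanish because `P` is the mean of `σ w`.
  have hsplit : ∑ w, σ w * I * σ w
      = (n : ℂ) • (P * I * P) + ∑ w, (σ w - P) * I * (σ w - P) := by
    have h0 : ∑ w, (σ w - P) = 0 := by
      rw [sum_sub_distrib, hmean, sum_const, card_univ, ← Nat.cast_smul_eq_nsmul ℂ, sub_self]
    have h1 : ∀ w, σ w * I * σ w
        = P * I * P + (P * I * (σ w - P) + (σ w - P) * (I * P))
          + (σ w - P) * I * (σ w - P) := fun w => by noncomm_ring
    have h2 : ∑ w, P * I * (σ w - P) = 0 := by rw [← Matrix.mul_sum, h0, Matrix.mul_zero]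
    have h3 : ∑ w, (σ w - P) * (I * P) = 0 := by rw [← Matrix.sum_mul, h0, Matrix.zero_mul]
    simp only [h1, sum_add_distrib]
    rw [h2, h3, sum_const, card_univ, ← Nat.cast_smul_eq_nsmul ℂ, add_zero, add_zero]
    rfl
  have hfluct : ∀ w, ((σ w - P) * I * (σ w - P)).trace.re
      ≤ ∑ x, ∑ y, (k * (d y.2)⁻¹) * ‖(σ w - P) x y‖ ^ 2 := fun w => by
    have hH : (σ w - P)ᴴ = σ w - P := by rw [conjTranspose_sub, hσ, hP.isHermitian.eq]
    have h1 := (Complex.le_def.1 (hinv.mul_mul_conjTranspose_same (σ w - P)).trace_nonneg).1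
    rw [Matrix.mul_sub, Matrix.sub_mul, trace_sub, Complex.sub_re, Complex.zero_re,
      sub_nonneg, hH] at h1
    refine h1.trans_eq ?_
    nth_rewrite 2 [← hH]
    have : ((σ w - P) * (diagonal fun x : Fin k × E => ((k * (d x.2)⁻¹ : ℝ) : ℂ))
        * (σ w - P)ᴴ).trace
        = ((∑ x, ∑ y, (k * (d y.2)⁻¹) * ‖(σ w - P) x y‖ ^ 2 : ℝ) : ℂ) := by
      rw [Complex.ofReal_sum]
      refine sum_congr rfl fun x _ => ?_
      rw [Complex.ofReal_sum, diag_apply, Matrix.mul_apply]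
      refine sum_congr rfl fun y _ => ?_
      rw [mul_diagonal, conjTranspose_apply, Complex.ofReal_mul (k * (d y.2)⁻¹), ofReal_norm_sq]
      ring
    rw [this, Complex.ofReal_re]
  calc ∑ w, (σ w * I * σ w).trace.re
      = n * (P * I * P).trace.re + ∑ w, ((σ w - P) * I * (σ w - P)).trace.re := by
        rw [← Complex.re_sum, ← trace_sum, hsplit, trace_add, trace_smul, Complex.add_re, trace_sum,
          Complex.re_sum, smul_eq_mul, Complex.re_ofReal_mul]
    _ ≤ n * totalNormSq ψ + ∑ w, ∑ x, ∑ y, (k * (d y.2)⁻¹) * ‖(σ w - P) x y‖ ^ 2 := by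
        gcongr
        · linarith
        · exact hfluct _
    _ = n * totalNormSq ψ + ∑ x, ∑ y, (k * (d y.2)⁻¹) * ∑ w, ‖(σ w - P) x y‖ ^ 2 := by
        rw [sum_comm]
        congr 1
        refine sum_congr rfl fun x _ => ?_
        rw [sum_comm]
        simp only [mul_sum]
    _ ≤ n * totalNormSq ψ + ∑ x : Fin k × E, ∑ y : Fin k × E, (k * (d y.2)⁻¹)
          * (n * (((k : ℝ)⁻¹) ^ 2 * ∑ a, ∑ a', ‖crossMarginal ψ x.2 y.2 a a'‖ ^ 2)) := by
        gcongr with x _ y _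
        · have := (hd y.2).le
          positivity
        · exact hvar x y
    _ = _ := by
        simp only [Fintype.sum_prod_type, sum_const, card_univ, Fintype.card_fin, nsmul_eq_mul]
        rw [mul_add, mul_sum, mul_sum, mul_sum]
        congr 1
        refine sum_congr rfl fun e _ => ?_
        rw [mul_sum, mul_sum, mul_sum, mul_sum]
        refine sum_congr rfl fun e' _ => ?_
        field_simp

end Moments

/-! ### The one-shot protocol -/

theorem encode_sub {A B E : Type*} [Fintype A] {k : ℕ} (w : Fin k × A → ZMod 3)
    (ψ ψ' : E → Matrix B A ℂ) : encode w (ψ - ψ') = encode w ψ - encode w ψ' := by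
  ext x b
  simp only [encode, of_apply, Pi.sub_apply, Matrix.sub_apply, mul_sub, sum_sub_distrib]

/-- Alice's Kraus operators form an exact instrument. -/
theorem sum_conjTranspose_mul_phase {A : Type*} [Fintype A] [DecidableEq A] {k : ℕ} {c : ℝ}
    (hc : c * c * (Fintype.card (Fin k × A → ZMod 3) * k) = 1) :
    ∑ w : Fin k × A → ZMod 3,
      ((c : ℂ) • Matrix.of fun (m : Fin k) (a : A) => phase w (m, a))ᴴ
        * ((c : ℂ) • Matrix.of fun (m : Fin k) (a : A) => phase w (m, a)) = 1 := by
  ext a a'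
  simp only [Matrix.sum_apply, Matrix.mul_apply, conjTranspose_apply, Matrix.smul_apply, of_apply,
    smul_eq_mul, star_mul', Complex.star_def, Complex.conj_ofReal]
  have : ∀ (w : Fin k × A → ZMod 3) (m : Fin k),
      (c : ℂ) * (starRingEnd ℂ) (phase w (m, a)) * (c * phase w (m, a'))
      = (c * c : ℂ) * (phase w (m, a') * star (phase w (m, a))) := fun w m => by
    rw [Complex.star_def]
    ring
  simp only [this, ← mul_sum]
  rw [sum_comm]
  simp only [sum_phase_mul_star_phase, Prod.mk.injEq, true_and, sum_const, card_univ,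
    Fintype.card_fin, nsmul_eq_mul, Matrix.one_apply, eq_comm (a := a')]
  split_ifs with h
  · rw [mul_comm (k : ℂ)]
    exact_mod_cast hc
  · simp

/-- The blocks of the complex conjugate of a contraction `C` are admissible Kraus operators for Bob.
The conjugate appears because vectors are paired with `M Cᴴ`, while Bob's operators act on them
without conjugation. -/
theorem posSemidef_one_sub_sum_blocks {B F : Type*} [Fintype B] [DecidableEq B] [Fintype F]
    {k : ℕ} (C : Matrix (Fin k × F) B ℂ) (hC : (1 - Cᴴ * C).PosSemidef) :
    (1 - ∑ f, (Matrix.of fun (m : Fin k) (b : B) => star (C (m, f) b))ᴴ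
      * (Matrix.of fun (m : Fin k) (b : B) => star (C (m, f) b))).PosSemidef := by
  suffices h : ∑ f, (Matrix.of fun (m : Fin k) (b : B) => star (C (m, f) b))ᴴ
      * (Matrix.of fun (m : Fin k) (b : B) => star (C (m, f) b)) = (Cᴴ * C)ᵀ by
    rw [h, ← transpose_one, ← transpose_sub]
    exact hC.transpose
  ext b b'
  simp only [Matrix.sum_apply, Matrix.mul_apply, conjTranspose_apply, of_apply, star_star,
    transpose_apply, Fintype.sum_prod_type]
  rw [sum_comm]
  exact sum_congr rfl fun m _ => sum_congr rfl fun f _ => mul_comm _ _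

/-- The overlap with a product target is a combination of Bob's amplitudes. -/
theorem norm_trace_target_sq_le {E : Type*} [Fintype E] {k : ℕ} (θ : Matrix E E ℂ)
    (Y : Matrix (Fin k × E) (Fin k × E) ℂ) (r : ℂ) :
    ‖((r • ((1 : Matrix (Fin k) (Fin k) ℂ) ⊗ₖ θ))ᴴ * Y).trace‖ ^ 2
      ≤ (θ * θᴴ).trace.re * ∑ e, ∑ f, ‖star r * ∑ m, Y (m, e) (m, f)‖ ^ 2 := by
  have : ((r • ((1 : Matrix (Fin k) (Fin k) ℂ) ⊗ₖ θ))ᴴ * Y).trace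
      = ∑ p : E × E, star (θ p.1 p.2) * (star r * ∑ m, Y (m, p.1) (m, p.2)) := by
    rw [trace_conjTranspose_mul]
    simp only [Fintype.sum_prod_type, Matrix.smul_apply, kroneckerMap_apply, Matrix.one_apply,
      ite_mul, one_mul, zero_mul, smul_eq_mul, mul_sum]
    rw [sum_comm]
    refine sum_congr rfl fun e _ => ?_
    have h1 : ∀ m : Fin k, ∑ m', ∑ f, star (r * if m = m' then θ e f else 0) * Y (m, e) (m', f)
        = ∑ f, star (r * θ e f) * Y (m, e) (m, f) := fun m => by
      rw [Fintype.sum_eq_single m fun m' hm => by simp [hm.symm]]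
      simp
    simp only [h1]
    rw [sum_comm]
    refine sum_congr rfl fun f _ => sum_congr rfl fun m _ => ?_
    rw [star_mul']
    ring
  rw [this, trace_mul_conjTranspose_re, ← Fintype.sum_prod_type' (f := fun i j => ‖θ i j‖ ^ 2),
    ← Fintype.sum_prod_type' (f := fun e f => ‖star r * ∑ m, Y (m, e) (m, f)‖ ^ 2)]
  exact norm_sum_star_mul_sq_le _ _

/-- A contraction on Bob's side does not increase the Frobenius norm. -/
theorem trace_mul_contraction_le {n b : Type*} [Fintype n] [Fintype b] [DecidableEq b]
    (N C : Matrix n b ℂ) (hC : (1 - Cᴴ * C).PosSemidef) :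
    ((N * Cᴴ) * (N * Cᴴ)ᴴ).trace.re ≤ (N * Nᴴ).trace.re := by
  have h := (Complex.le_def.1 (hC.mul_mul_conjTranspose_same N).trace_nonneg).1
  rw [Matrix.mul_sub, Matrix.sub_mul, trace_sub, Matrix.mul_one, Complex.sub_re, Complex.zero_re,
    sub_nonneg] at h
  simpa only [conjTranspose_mul, conjTranspose_conjTranspose, Matrix.mul_assoc] using h

/-- One-shot entanglement distillation. The protocol is built from vectors `ψ'` close to the vectors
`ψ` that decompose the actual state; `d` regularises the environment. The amplitude `g` falls short
of the weight of `ψ'` by the fluctuation of the encoded state (the term with `k`) and by the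
replacement of `ψ'` by `ψ` in the overlap; `totalNormSq ψ' + ∑ e, d e` normalises the target. -/
theorem exists_oneShot_protocol {A B E : Type*} [Fintype A] [DecidableEq A] [Fintype B]
    [DecidableEq B] [Fintype E] [DecidableEq E] {k : ℕ} (hk : 1 ≤ k) (ψ ψ' : E → Matrix B A ℂ)
    (d : E → ℝ) (hd : ∀ e, 0 < d e)
    (hW : 0 < totalNormSq ψ' + ∑ e, d e) :
    ∃ T : Matrix (A × B) (A × B) ℂ →ₗ[ℂ] Matrix (Fin k × Fin k) (Fin k × Fin k) ℂ,
      IsOneWayLOCC T ∧ (∀ X, X.PosSemidef → (T X).PosSemidef) ∧ IsTracePreserving T ∧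
      ∀ g : ℝ, 0 ≤ g → g ≤ totalNormSq ψ'
        - k / 2 * ∑ e, ∑ e', (d e')⁻¹ * ∑ a, ∑ a', ‖crossMarginal ψ' e e' a a'‖ ^ 2
        - √(totalNormSq ψ' + ∑ e, d e) * √(totalNormSq (ψ - ψ')) →
      g ^ 2 / (totalNormSq ψ' + ∑ e, d e) ≤ (star (maxEntVec k) ⬝ᵥ
        T (∑ e, vecMulVec (fun x : A × B => ψ e x.2 x.1) (star fun x : A × B => ψ e x.2 x.1))
          *ᵥ maxEntVec k).re := by
  have hk0 : (0 : ℝ) < k := by exact_mod_cast hk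
  set n : ℝ := (Fintype.card (Fin k × A → ZMod 3) : ℝ) with hn
  have hn0 : 0 < n := by
    rw [hn]
    exact_mod_cast Fintype.card_pos
  set W := totalNormSq ψ' + ∑ e, d e with hWdef
  set Q := ∑ e, ∑ e', (d e')⁻¹ * ∑ a, ∑ a', ‖crossMarginal ψ' e e' a a'‖ ^ 2 with hQ
  -- The target on the environment.
  have hω : (envMarginal ψ' + diagonal fun e => (d e : ℂ)).PosSemidef :=
    (envMarginal_posSemidef ψ').add (PosSemidef.diagonal fun e => by
      simpa using (hd e).le)
  obtain ⟨θ, hθ, hθθ⟩ := exists_sqrt hω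
  have hθ' : θ * θᴴ = envMarginal ψ' + diagonal fun e => (d e : ℂ) := by
    rw [hθ.isHermitian.eq, hθθ]
  have hθtr : (θ * θᴴ).trace = (W : ℂ) := by
    rw [hθ', trace_add, trace_envMarginal, trace_diagonal, hWdef]
    push_cast
    rfl
  set r : ℂ := (((√k)⁻¹ : ℝ) : ℂ) with hr
  have hrr : r * r = (k : ℂ)⁻¹ := inv_sqrt_mul_self k
  have hrs : star r = r := Complex.conj_ofReal _
  set T₀ : Matrix (Fin k × E) (Fin k × E) ℂ := r • ((1 : Matrix (Fin k) (Fin k) ℂ) ⊗ₖ θ) with hT₀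
  set τ : Matrix (Fin k × E) (Fin k × E) ℂ :=
    decoupled k ψ' + diagonal fun x : Fin k × E => (((k : ℝ)⁻¹ * d x.2 : ℝ) : ℂ) with hτdef
  have hτ : τ.PosDef := by
    rw [hτdef, add_comm]
    refine (PosDef.diagonal fun x => ?_).add_posSemidef (decoupled_posSemidef ψ')
    exact_mod_cast mul_pos (inv_pos.2 hk0) (hd x.2)
  have hτT : τ = T₀ * T₀ᴴ := by
    rw [hT₀, conjTranspose_smul, hrs, smul_mul_smul_comm, hrr, conjTranspose_kronecker,
      conjTranspose_one, ← mul_kronecker_mul, hθ', hτdef, decoupled, kronecker_add, smul_add]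
    simp only [Matrix.one_mul]
    congr 1
    ext x y
    simp only [Matrix.smul_apply, kroneckerMap_apply, Matrix.one_apply, diagonal_apply,
      Prod.ext_iff]
    by_cases h1 : x.1 = y.1 <;> by_cases h2 : x.2 = y.2 <;> simp [h1, h2]
  have hTtr : (T₀ * T₀ᴴ).trace.re = W := by
    rw [hT₀, conjTranspose_smul, hrs, smul_mul_smul_comm, hrr, conjTranspose_kronecker,
      conjTranspose_one, ← mul_kronecker_mul, trace_smul, trace_kronecker, hθtr, Matrix.one_mul,
      trace_one, Fintype.card_fin, smul_eq_mul, inv_mul_cancel_left₀, Complex.ofReal_re]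
    exact_mod_cast hk0.ne'
  -- Bob's contractions, one for each outcome.
  choose C hC hov using fun w : Fin k × A → ZMod 3 =>
    exists_contraction_overlap (encode w ψ') hτ hτT
  set c : ℝ := (√n)⁻¹ * (√k)⁻¹ with hc
  have hcc : c * c * (n * k) = 1 := by
    have h1 : (√n)⁻¹ * (√n)⁻¹ = n⁻¹ := by rw [← mul_inv, Real.mul_self_sqrt hn0.le]
    have h2 : (√(k : ℝ))⁻¹ * (√k)⁻¹ = (k : ℝ)⁻¹ := by rw [← mul_inv, Real.mul_self_sqrt hk0.le]
    rw [hc, mul_mul_mul_comm (√n)⁻¹, h1, h2]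
    field_simp
  obtain ⟨T, hT, hTpos, hTtp, hTamp⟩ := exists_oneWayLOCC (E := E) hk
    (fun w : Fin k × A → ZMod 3 =>
      (c : ℂ) • Matrix.of fun (m : Fin k) (a : A) => phase w (m, a))
    (sum_conjTranspose_mul_phase hcc)
    (fun w f => Matrix.of fun (m : Fin k) (b : B) => star (C w (m, f) b))
    (fun w => posSemidef_one_sub_sum_blocks (C w) (hC w))
  refine ⟨T, hT, hTpos, hTtp, fun g hg0 hg => le_trans ?_ (hTamp fun e x => ψ e x.2 x.1)⟩
  -- The actual overlap for the outcome `w`.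
  let o : (Fin k × A → ZMod 3) → ℝ := fun w => (T₀ᴴ * (encode w ψ * (C w)ᴴ)).trace.re
  have hamp : ∀ w e f, (((√k)⁻¹ : ℝ) : ℂ) * ∑ m, ∑ b,
        (Matrix.of fun (m : Fin k) (b : B) => star (C w (m, f) b)) m b
        * ∑ a, ((c : ℂ) • Matrix.of fun (m : Fin k) (a : A) => phase w (m, a)) m a * ψ e b a
      = (((√n)⁻¹ : ℝ) : ℂ) * (star r * ∑ m, (encode w ψ * (C w)ᴴ) (m, e) (m, f)) := fun w e f => by
    rw [mul_left_comm, hrs]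
    congr 1
    rw [mul_sum]
    refine sum_congr rfl fun m _ => ?_
    rw [Matrix.mul_apply, mul_sum]
    refine sum_congr rfl fun b _ => ?_
    simp only [encode, of_apply, conjTranspose_apply, Matrix.smul_apply, smul_eq_mul, mul_assoc,
      ← mul_sum]
    rw [hc]
    push_cast
    ring
  have hbound : ∀ w, n⁻¹ * (o w ^ 2 / W) ≤ ∑ e, ∑ f, ‖(((√k)⁻¹ : ℝ) : ℂ) * ∑ m, ∑ b,
        (Matrix.of fun (m : Fin k) (b : B) => star (C w (m, f) b)) m b
        * ∑ a, ((c : ℂ) • Matrix.of fun (m : Fin k) (a : A) => phase w (m, a)) m a * ψ e b a‖ ^ 2 :=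
      fun w => by
    have h1 := norm_trace_target_sq_le θ (encode w ψ * (C w)ᴴ) r
    have h2 : o w ^ 2 ≤ ‖(T₀ᴴ * (encode w ψ * (C w)ᴴ)).trace‖ ^ 2 := by
      rw [← sq_abs]
      gcongr
      exact Complex.abs_re_le_norm _
    rw [hθtr, Complex.ofReal_re] at h1
    have h3 : ‖(((√n)⁻¹ : ℝ) : ℂ)‖ ^ 2 = n⁻¹ := by
      rw [Complex.norm_real, Real.norm_eq_abs, sq_abs, inv_pow, Real.sq_sqrt hn0.le]
    simp only [hamp, norm_mul (((√n)⁻¹ : ℝ) : ℂ), mul_pow, h3, ← mul_sum]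
    gcongr
    rw [div_le_iff₀' hW]
    exact h2.trans h1
  refine le_trans ?_ (sum_le_sum fun w _ => hbound w)
  rw [← mul_sum, ← sum_div]
  -- On average the overlap computed with `ψ'` is large, and `ψ` is close to `ψ'`.
  have hsum : n * g ≤ ∑ w, o w := by
    have hdec : ∀ w, 3 / 2 * (encode w ψ' * (encode w ψ')ᴴ).trace.re
        - 1 / 2 * (encode w ψ' * (encode w ψ')ᴴ * τ⁻¹
          * (encode w ψ' * (encode w ψ')ᴴ)).trace.re
        - √W * √(encode w (ψ - ψ') * (encode w (ψ - ψ'))ᴴ).trace.re ≤ o w := fun w => by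
      have h1 := norm_trace_conjTranspose_mul_sq_le T₀ (encode w (ψ - ψ') * (C w)ᴴ)
      have h2 := trace_mul_contraction_le (encode w (ψ - ψ')) (C w) (hC w)
      rw [hTtr] at h1
      have h3 : ‖(T₀ᴴ * (encode w (ψ - ψ') * (C w)ᴴ)).trace‖
          ≤ √W * √(encode w (ψ - ψ') * (encode w (ψ - ψ'))ᴴ).trace.re := by
        rw [← Real.sqrt_mul hW.le]
        exact Real.le_sqrt_of_sq_le (h1.trans (by gcongr))
      have h4 := (abs_le.1 ((Complex.abs_re_le_norm _).trans h3)).1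
      have h5 : o w = (T₀ᴴ * encode w ψ' * (C w)ᴴ).trace.re
          + (T₀ᴴ * (encode w (ψ - ψ') * (C w)ᴴ)).trace.re := by
        rw [← Complex.add_re, ← trace_add, Matrix.mul_assoc, ← Matrix.mul_add, ← Matrix.add_mul,
          encode_sub, add_sub_cancel]
      have h6 := hov w
      linarith
    have hs1 := sum_totalNormSq_encode (A := A) hk ψ'
    have hs2 := sum_trace_encode_inv_le hk ψ' d hd
    have hs3 : ∑ w : Fin k × A → ZMod 3, √(encode w (ψ - ψ') * (encode w (ψ - ψ'))ᴴ).trace.re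
        ≤ n * √(totalNormSq (ψ - ψ')) := by
      have h1 := sum_totalNormSq_encode (A := A) hk (ψ - ψ')
      have h2 := sq_sum_le_card_mul_sum_sq (s := (univ : Finset (Fin k × A → ZMod 3)))
        (f := fun w => √(encode w (ψ - ψ') * (encode w (ψ - ψ'))ᴴ).trace.re)
      have h3 : ∀ w : Fin k × A → ZMod 3, √(encode w (ψ - ψ') * (encode w (ψ - ψ'))ᴴ).trace.re ^ 2
          = (encode w (ψ - ψ') * (encode w (ψ - ψ'))ᴴ).trace.re := fun w => by
        refine Real.sq_sqrt ?_
        rw [trace_mul_conjTranspose_re]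
        positivity
      simp only [h3, h1, card_univ, ← hn] at h2
      refine le_trans (Real.le_sqrt_of_sq_le h2) (le_of_eq ?_)
      rw [← mul_assoc, Real.sqrt_mul (by positivity), Real.sqrt_mul_self hn0.le]
    have hs4 := sum_le_sum fun w (_ : w ∈ univ) => hdec w
    rw [sum_sub_distrib, sum_sub_distrib, ← mul_sum, ← mul_sum, ← mul_sum, hs1] at hs4
    have hs5 := mul_le_mul_of_nonneg_left hs3 (Real.sqrt_nonneg W)
    have hs6 := mul_le_mul_of_nonneg_left hg hn0.le
    rw [← hτdef, ← hQ, ← hn] at hs2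
    rw [← hn] at hs4
    refine hs6.trans (le_trans ?_ hs4)
    nlinarith [hs2, hs5]
  have h1 := sq_sum_le_card_mul_sum_sq (s := (univ : Finset (Fin k × A → ZMod 3))) (f := o)
  rw [card_univ, ← hn] at h1
  have h2 : (n * g) ^ 2 ≤ (∑ w, o w) ^ 2 := by gcongr
  rw [← mul_div_assoc]
  gcongr
  rw [le_inv_mul_iff₀ hn0]
  have h3 := h2.trans h1
  rw [mul_pow, sq n, mul_assoc] at h3
  exact le_of_mul_le_mul_left h3 hn0

/-! ### Typical sequences -/

theorem sum_pi_prod {X R : Type*} [Fintype X] [CommSemiring R] {l : ℕ} (f : Fin l → X → R) :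
    ∑ x : Fin l → X, ∏ t, f t (x t) = ∏ t, ∑ a, f t a := by
  rw [prod_univ_sum, Fintype.piFinset_univ]

/-- The second moment of a sum of independent centred variables: the cross terms vanish. -/
theorem sum_prod_mul_sq {X : Type*} [Fintype X] (p f : X → ℝ) (hp : ∑ a, p a = 1)
    (hf : ∑ a, p a * f a = 0) (l : ℕ) :
    ∑ x : Fin l → X, (∏ t, p (x t)) * (∑ t, f (x t)) ^ 2 = l * ∑ a, p a * f a ^ 2 := by
  have hcons : ∀ (l : ℕ) (F : (Fin (l + 1) → X) → ℝ),
      ∑ x, F x = ∑ a, ∑ x : Fin l → X, F (Fin.cons a x) := fun l F => by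
    rw [← (Fin.consEquiv fun _ => X).sum_comp, Fintype.sum_prod_type]
    rfl
  have hmass : ∀ l : ℕ, ∑ x : Fin l → X, ∏ t, p (x t) = 1 := fun l => by
    rw [sum_pi_prod (fun _ => p)]
    simp [hp]
  have hmean : ∀ l : ℕ, ∑ x : Fin l → X, (∏ t, p (x t)) * ∑ t, f (x t) = 0 := fun l => by
    induction l with
    | zero => simp
    | succ l ih =>
      rw [hcons]
      simp only [Fin.prod_univ_succ, Fin.sum_univ_succ, Fin.cons_zero, Fin.cons_succ]
      have : ∀ a, ∑ x : Fin l → X, p a * (∏ t, p (x t)) * (f a + ∑ t, f (x t))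
          = p a * f a := fun a => by
        have : ∀ x : Fin l → X, p a * (∏ t, p (x t)) * (f a + ∑ t, f (x t))
            = p a * f a * ∏ t, p (x t) + p a * ((∏ t, p (x t)) * ∑ t, f (x t)) := fun x => by ring
        simp only [this, sum_add_distrib, ← mul_sum, hmass, ih]
        ring
      simp only [this, hf]
  induction l with
  | zero => simp
  | succ l ih =>
    rw [hcons]
    simp only [Fin.prod_univ_succ, Fin.sum_univ_succ, Fin.cons_zero, Fin.cons_succ]
    have : ∀ a, ∑ x : Fin l → X, p a * (∏ t, p (x t)) * (f a + ∑ t, f (x t)) ^ 2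
        = p a * f a ^ 2 + p a * (l * ∑ a, p a * f a ^ 2) := fun a => by
      have : ∀ x : Fin l → X, p a * (∏ t, p (x t)) * (f a + ∑ t, f (x t)) ^ 2
          = p a * f a ^ 2 * ∏ t, p (x t) + 2 * p a * f a * ((∏ t, p (x t)) * ∑ t, f (x t))
            + p a * ((∏ t, p (x t)) * (∑ t, f (x t)) ^ 2) := fun x => by ring
      simp only [this, sum_add_distrib, ← mul_sum, hmass, hmean, ih]
      ring
    simp only [this, sum_add_distrib, ← sum_mul, hp]
    push_cast
    ring

/-- The asymptotic equipartition property: for a product distribution the sequences that are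
much less likely or much more likely than `2 ^ (-l H)` have small total probability. Sequences of
probability zero, where `Real.logb` takes a junk value, do not contribute to the sums. -/
theorem exists_typical_bound {X : Type*} [Fintype X] (p : X → ℝ) (hp0 : ∀ a, 0 ≤ p a)
    (hp : ∑ a, p a = 1) {δ : ℝ} (hδ : 0 < δ) :
    ∃ v : ℝ, 0 ≤ v ∧ ∀ l : ℕ, 1 ≤ l →
      (∑ x : Fin l → X, if (2 : ℝ) ^ (-(l * (-(∑ a, p a * Real.logb 2 (p a)) + δ)))
          ≤ ∏ t, p (x t) then 0 else ∏ t, p (x t)) ≤ v / l ∧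
      (∑ x : Fin l → X, if ∏ t, p (x t)
          ≤ (2 : ℝ) ^ (-(l * (-(∑ a, p a * Real.logb 2 (p a)) - δ)))
          then 0 else ∏ t, p (x t)) ≤ v / l := by
  set H := -(∑ a, p a * Real.logb 2 (p a)) with hH
  let f : X → ℝ := fun a => -Real.logb 2 (p a) - H
  have hf : ∑ a, p a * f a = 0 := by
    simp only [f, mul_sub, mul_neg, sum_sub_distrib, sum_neg_distrib, ← sum_mul, hp]
    rw [hH]
    ring
  have hv0 : 0 ≤ ∑ a, p a * f a ^ 2 := sum_nonneg fun a _ => mul_nonneg (hp0 a) (sq_nonneg _)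
  have hprod : ∀ {l : ℕ} (x : Fin l → X), 0 ≤ ∏ t, p (x t) := fun x =>
    prod_nonneg fun t _ => hp0 _
  have hsum : ∀ {l : ℕ} (x : Fin l → X), 0 < ∏ t, p (x t) →
      ∑ t, f (x t) = -Real.logb 2 (∏ t, p (x t)) - l * H := fun {l} x hx => by
    rw [Real.logb_prod _ _ fun t _ h => hx.ne' (prod_eq_zero (mem_univ t) h)]
    simp [f]
  have hcheb : ∀ (l : ℕ), 1 ≤ l → ∀ P : (Fin l → X) → Prop, ∀ [DecidablePred P],
      (∀ x, ¬ P x → 0 < ∏ t, p (x t) → (l * δ) ^ 2 ≤ (∑ t, f (x t)) ^ 2) →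
      (∑ x : Fin l → X, if P x then 0 else ∏ t, p (x t))
        ≤ ((∑ a, p a * f a ^ 2) / δ ^ 2) / l := fun l hl P _ h => by
    have hl0 : (0 : ℝ) < l := by exact_mod_cast hl
    have h1 : (∑ x : Fin l → X, if P x then 0 else ∏ t, p (x t)) * (l * δ) ^ 2
        ≤ l * ∑ a, p a * f a ^ 2 := by
      rw [← sum_prod_mul_sq p f hp hf l, sum_mul]
      refine sum_le_sum fun x _ => ?_
      split_ifs with hP
      · rw [zero_mul]
        exact mul_nonneg (hprod x) (sq_nonneg _)
      · rcases (hprod x).eq_or_lt with h0 | h0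
        · rw [← h0, zero_mul, zero_mul]
        · exact mul_le_mul_of_nonneg_left (h x hP h0) h0.le
    rw [div_div, le_div_iff₀ (by positivity)]
    refine le_of_mul_le_mul_left ?_ hl0
    refine le_trans (le_of_eq ?_) h1
    ring
  refine ⟨(∑ a, p a * f a ^ 2) / δ ^ 2, by positivity, fun l hl => ⟨?_, ?_⟩⟩
  · refine hcheb l hl _ fun x hx h0 => ?_
    rw [hsum x h0]
    have h1 := (Real.logb_lt_iff_lt_rpow one_lt_two h0).2 (not_le.1 hx)
    refine pow_le_pow_left₀ (by positivity) ?_ 2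
    linarith
  · refine hcheb l hl _ fun x hx h0 => ?_
    rw [hsum x h0, ← neg_sq (-Real.logb 2 (∏ t, p (x t)) - l * H)]
    have h1 := (Real.lt_logb_iff_rpow_lt one_lt_two h0).2 (not_le.1 hx)
    refine pow_le_pow_left₀ (by positivity) ?_ 2
    linarith

/-! ### Spectral decompositions and tensor powers -/

theorem isState_exists_spectral {m : Type*} [Fintype m] [DecidableEq m] {ρ : Matrix m m ℂ}
    (hρ : IsState ρ) : ∃ (U : Matrix m m ℂ) (p : m → ℝ), Uᴴ * U = 1 ∧ U * Uᴴ = 1 ∧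
      ρ = U * diagonal (fun i => (p i : ℂ)) * Uᴴ ∧ (∀ i, 0 ≤ p i) ∧ ∑ i, p i = 1 ∧
      entropy ρ = -∑ i, p i * Real.logb 2 (p i) := by
  have hH := hρ.1.isHermitian
  have hU1 : (hH.eigenvectorUnitary : Matrix m m ℂ)ᴴ * hH.eigenvectorUnitary = 1 :=
    Unitary.coe_star_mul_self _
  have hU2 : (hH.eigenvectorUnitary : Matrix m m ℂ) * (hH.eigenvectorUnitary : Matrix m m ℂ)ᴴ = 1 :=
    Unitary.coe_mul_star_self _
  have hspec := hH.spectral_theorem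
  rw [Unitary.conjStarAlgAut_apply] at hspec
  have hcfc := hH.cfc_eq (Real.logb 2)
  rw [IsHermitian.cfc, Unitary.conjStarAlgAut_apply] at hcfc
  set U := (hH.eigenvectorUnitary : Matrix m m ℂ)
  have hspec' : ρ = U * diagonal (fun i => (hH.eigenvalues i : ℂ)) * Uᴴ := hspec
  refine ⟨U, hH.eigenvalues, hU1, hU2, hspec', hρ.1.eigenvalues_nonneg, ?_, ?_⟩
  · have h := hρ.2
    rw [hspec', trace_mul_comm, ← Matrix.mul_assoc, hU1, Matrix.one_mul, trace_diagonal] at h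
    exact_mod_cast h
  · have h : (ρ * cfc (Real.logb 2) ρ).trace
        = ((∑ i, hH.eigenvalues i * Real.logb 2 (hH.eigenvalues i) : ℝ) : ℂ) := by
      have hcfc' : cfc (Real.logb 2) ρ
          = U * diagonal (fun i => (Real.logb 2 (hH.eigenvalues i) : ℂ)) * Uᴴ := hcfc
      rw [hcfc']
      nth_rewrite 1 [hspec']
      rw [show U * diagonal (fun i => (hH.eigenvalues i : ℂ)) * Uᴴ
          * (U * diagonal (fun i => (Real.logb 2 (hH.eigenvalues i) : ℂ)) * Uᴴ)
          = U * (diagonal (fun i => (hH.eigenvalues i : ℂ)) * (Uᴴ * U)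
            * diagonal (fun i => (Real.logb 2 (hH.eigenvalues i) : ℂ))) * Uᴴ by
        simp only [Matrix.mul_assoc], hU1, trace_mul_comm, ← Matrix.mul_assoc, hU1, Matrix.one_mul,
        Matrix.mul_one, diagonal_mul_diagonal, trace_diagonal]
      push_cast
      rfl
    rw [entropy, h, Complex.ofReal_re]

theorem isState_traceFst {a b : Type*} [Fintype a] [DecidableEq a] [Fintype b]
    {ρ : Matrix (a × b) (a × b) ℂ} (hρ : IsState ρ) : IsState (traceFst ρ) := by
  refine ⟨?_, ?_⟩
  · have : traceFst ρ = ∑ i, ρ.submatrix (fun j => (i, j)) (fun j => (i, j)) := by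
      ext j j'
      simp [traceFst, Matrix.sum_apply]
    rw [this]
    exact posSemidef_sum _ fun i _ => hρ.1.submatrix _
  · rw [← hρ.2]
    simp only [traceFst, trace, diag_apply, of_apply, Fintype.sum_prod_type]
    exact sum_comm

/-- The tensor power of a matrix on a single system. -/
def tpow {m n : Type*} (l : ℕ) (M : Matrix m n ℂ) : Matrix (Fin l → m) (Fin l → n) ℂ :=
  Matrix.of fun x y => ∏ t, M (x t) (y t)

theorem tpow_mul {m n o : Type*} [Fintype n] (l : ℕ) (M : Matrix m n ℂ) (N : Matrix n o ℂ) :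
    tpow l (M * N) = tpow l M * tpow l N := by
  ext x y
  simp only [tpow, of_apply, Matrix.mul_apply, ← prod_mul_distrib]
  exact (sum_pi_prod fun t a => M (x t) a * N a (y t)).symm

theorem tpow_conjTranspose {m n : Type*} (l : ℕ) (M : Matrix m n ℂ) :
    tpow l Mᴴ = (tpow l M)ᴴ := by
  ext x y
  simp [tpow]

theorem tpow_diagonal {m : Type*} [DecidableEq m] (l : ℕ) (q : m → ℂ) :
    tpow l (diagonal q) = diagonal fun x : Fin l → m => ∏ t, q (x t) := by
  ext x y
  simp only [tpow, of_apply, diagonal_apply]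
  split_ifs with h
  · subst h
    simp
  · obtain ⟨t, ht⟩ := Function.ne_iff.1 h
    exact prod_eq_zero (mem_univ t) (if_neg ht)

theorem tpow_one {m : Type*} [DecidableEq m] (l : ℕ) :
    tpow l (1 : Matrix m m ℂ) = 1 := by
  rw [← diagonal_one, tpow_diagonal]
  simp

/-! ### Smoothed purifications of tensor powers -/

/-- A projection `P` splits vectors orthogonally. -/
theorem sum_norm_sq_projection {m n : Type*} [Fintype m] [DecidableEq m] [Fintype n]
    {P : Matrix m m ℂ} (hP : Pᴴ = P) (hPP : P * P = P) (X : Matrix m n ℂ) :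
    ∑ i, ∑ j, ‖X i j‖ ^ 2 = ∑ i, ∑ j, ‖(P * X) i j‖ ^ 2 + ∑ i, ∑ j, ‖(X - P * X) i j‖ ^ 2 := by
  simp only [← trace_mul_conjTranspose_re]
  rw [← Complex.add_re, ← trace_add]
  congr 1
  have h1 : (P * X * (P * X)ᴴ).trace = (P * (X * Xᴴ)).trace := by
    rw [conjTranspose_mul, hP, ← Matrix.mul_assoc, trace_mul_comm, ← Matrix.mul_assoc,
      ← Matrix.mul_assoc, hPP, Matrix.mul_assoc]
  have h2 : (P * X * Xᴴ).trace = (P * (X * Xᴴ)).trace := by rw [Matrix.mul_assoc]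
  have h3 : (X * (P * X)ᴴ).trace = (P * (X * Xᴴ)).trace := by
    rw [conjTranspose_mul, hP, ← Matrix.mul_assoc, trace_mul_comm]
  rw [conjTranspose_sub, Matrix.mul_sub, Matrix.sub_mul, Matrix.sub_mul, trace_add, trace_sub,
    trace_sub, trace_sub, h1, h2, h3]
  ring

theorem traceFst_tensorPow {a b : Type*} [Fintype a] (l : ℕ) (ρ : Matrix (a × b) (a × b) ℂ) :
    traceFst (tensorPow l ρ) = tpow l (traceFst ρ) := by
  ext y y'
  simp only [traceFst, tensorPow, tpow, of_apply]
  exact sum_pi_prod fun t i => ρ (i, y t) (i, y' t)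

/-- The spectral vectors of a tensor power, smoothed. The vectors `ψ j` decompose `ρ^{⊗ l}`, have
squared norms `w j`, and are replaced by `0` when `j` is an atypically unlikely eigenvalue sequence,
and by their projections to the subspace where `ρ_B^{⊗ l}` has small eigenvalues otherwise. -/
theorem exists_smoothed_vectors {a b : Type*} [Fintype a] [DecidableEq a] [Fintype b]
    [DecidableEq b] {ρ : Matrix (a × b) (a × b) ℂ} (hρ : IsState ρ) {δ : ℝ} (hδ : 0 < δ) :
    ∃ v : ℝ, 0 ≤ v ∧ ∀ l : ℕ, 1 ≤ l →
      ∃ (ψ ψ' : (Fin l → a × b) → Matrix (Fin l → b) (Fin l → a) ℂ)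
        (w : (Fin l → a × b) → ℝ),
        tensorPow l ρ = ∑ j, vecMulVec (fun x : (Fin l → a) × (Fin l → b) => ψ j x.2 x.1)
          (star fun x : (Fin l → a) × (Fin l → b) => ψ j x.2 x.1) ∧
        (∀ j, 0 ≤ w j) ∧ ∑ j, w j = 1 ∧
        totalNormSq ψ' ≤ 1 ∧ 1 - v / l ≤ totalNormSq ψ' ∧ totalNormSq (ψ - ψ') ≤ v / l ∧
        (∀ j, ψ' j = 0 ∨ (2 : ℝ) ^ (-(l * (entropy ρ + δ))) ≤ w j) ∧
        ((((2 : ℝ) ^ (-(l * (entropy (traceFst ρ) - δ))) : ℝ) : ℂ) • 1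
          - ∑ j, ψ' j * (ψ' j)ᴴ).PosSemidef := by
  obtain ⟨U, p, hU, -, hρU, hp0, hp1, hent⟩ := isState_exists_spectral hρ
  obtain ⟨V, q, hV, hV', hρV, hq0, hq1, hent'⟩ := isState_exists_spectral (isState_traceFst hρ)
  obtain ⟨v₁, hv₁, hA⟩ := exists_typical_bound p hp0 hp1 hδ
  obtain ⟨v₂, hv₂, hB⟩ := exists_typical_bound q hq0 hq1 hδ
  rw [← hent] at hA
  rw [← hent'] at hB
  refine ⟨v₁ + v₂, by positivity, fun l hl => ?_⟩
  have hAl := (hA l hl).1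
  have hBl := (hB l hl).2
  set cA : ℝ := (2 : ℝ) ^ (-(l * (entropy ρ + δ)))
  set cB : ℝ := (2 : ℝ) ^ (-(l * (entropy (traceFst ρ) - δ)))
  have hcB : 0 ≤ cB := by positivity
  let w : (Fin l → a × b) → ℝ := fun j => ∏ t, p (j t)
  have hw0 : ∀ j, 0 ≤ w j := fun j => prod_nonneg fun t _ => hp0 _
  have hw1 : ∑ j, w j = 1 := by
    rw [sum_pi_prod fun _ : Fin l => p]
    simp [hp1]
  let u : (Fin l → b) → ℝ := fun j => ∏ t, q (j t)
  have hu0 : ∀ j, 0 ≤ u j := fun j => prod_nonneg fun t _ => hq0 _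
  have hu1 : ∑ j, u j = 1 := by
    rw [sum_pi_prod fun _ : Fin l => q]
    simp [hq1]
  let ψ : (Fin l → a × b) → Matrix (Fin l → b) (Fin l → a) ℂ := fun j =>
    Matrix.of fun y x => ∏ t, ((√(p (j t)) : ℝ) : ℂ) * U (x t, y t) (j t)
  have hsq : ∀ c : ℝ, 0 ≤ c → (√c : ℂ) * √c = c := fun c hc => by
    rw [← Complex.ofReal_mul, Real.mul_self_sqrt hc]
  have hdec : tensorPow l ρ = ∑ j, vecMulVec (fun x : (Fin l → a) × (Fin l → b) => ψ j x.2 x.1)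
      (star fun x : (Fin l → a) × (Fin l → b) => ψ j x.2 x.1) := by
    ext x y
    have hentry : ∀ z z' : a × b, ρ z z' = ∑ i, (((√(p i) : ℝ) : ℂ) * U z i)
        * star (((√(p i) : ℝ) : ℂ) * U z' i) := fun z z' => by
      conv_lhs => rw [hρU]
      rw [Matrix.mul_apply]
      refine sum_congr rfl fun i _ => ?_
      rw [mul_diagonal, conjTranspose_apply, star_mul', Complex.star_def, Complex.conj_ofReal,
        mul_mul_mul_comm, hsq _ (hp0 i)]
      ring
    simp only [tensorPow, of_apply, Matrix.sum_apply, vecMulVec_apply, Pi.star_apply, ψ, star_prod,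
      ← prod_mul_distrib, hentry]
    exact (sum_pi_prod fun t i => (((√(p i) : ℝ) : ℂ) * U (x.1 t, x.2 t) i)
      * star (((√(p i) : ℝ) : ℂ) * U (y.1 t, y.2 t) i)).symm
  have hnorm : ∀ j, ∑ y, ∑ x, ‖ψ j y x‖ ^ 2 = w j := fun j => by
    have h1 : ∀ i, ∑ y, ∑ x, ‖((√(p i) : ℝ) : ℂ) * U (x, y) i‖ ^ 2 = p i := fun i => by
      have h2 : ∑ z, ‖U z i‖ ^ 2 = 1 := by
        have h3 := congrFun (congrFun hU i) i
        rw [Matrix.mul_apply, one_apply_eq] at h3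
        apply Complex.ofReal_injective
        rw [Complex.ofReal_sum, Complex.ofReal_one, ← h3]
        refine sum_congr rfl fun z _ => ?_
        rw [ofReal_norm_sq, conjTranspose_apply, mul_comm]
      rw [sum_comm, ← Fintype.sum_prod_type'
        (f := fun x y => ‖((√(p i) : ℝ) : ℂ) * U (x, y) i‖ ^ 2)]
      simp only [norm_mul, mul_pow, ← mul_sum, Prod.mk.eta, h2]
      rw [Complex.norm_real, Real.norm_eq_abs, sq_abs, Real.sq_sqrt (hp0 i), mul_one]
    simp only [ψ, of_apply, norm_prod, ← prod_pow]
    have h4 : ∀ y : Fin l → b, ∑ x : Fin l → a,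
        ∏ t, ‖((√(p (j t)) : ℝ) : ℂ) * U (x t, y t) (j t)‖ ^ 2
        = ∏ t, ∑ x, ‖((√(p (j t)) : ℝ) : ℂ) * U (x, y t) (j t)‖ ^ 2 := fun y =>
      sum_pi_prod fun t x => ‖((√(p (j t)) : ℝ) : ℂ) * U (x, y t) (j t)‖ ^ 2
    simp only [h4]
    rw [sum_pi_prod fun t y => ∑ x, ‖((√(p (j t)) : ℝ) : ℂ) * U (x, y) (j t)‖ ^ 2]
    exact prod_congr rfl fun t _ => h1 _
  -- Bob's projection onto the eigenvectors with small eigenvalues.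
  set Vl := tpow l V with hVl
  have hVl1 : Vlᴴ * Vl = 1 := by rw [hVl, ← tpow_conjTranspose, ← tpow_mul, hV, tpow_one]
  have hVl2 : Vl * Vlᴴ = 1 := by rw [hVl, ← tpow_conjTranspose, ← tpow_mul, hV', tpow_one]
  have hconj : ∀ D D' : Matrix (Fin l → b) (Fin l → b) ℂ,
      (Vl * D * Vlᴴ) * (Vl * D' * Vlᴴ) = Vl * (D * D') * Vlᴴ := fun D D' => by
    rw [show (Vl * D * Vlᴴ) * (Vl * D' * Vlᴴ) = Vl * D * (Vlᴴ * Vl) * D' * Vlᴴ by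
      simp only [Matrix.mul_assoc], hVl1, Matrix.mul_one]
    simp only [Matrix.mul_assoc]
  have hβ : ∑ j, ψ j * (ψ j)ᴴ = Vl * diagonal (fun y => (u y : ℂ)) * Vlᴴ := by
    have h1 : ∑ j, ψ j * (ψ j)ᴴ = tpow l (traceFst ρ) := by
      rw [← traceFst_tensorPow, hdec]
      ext y y'
      simp only [traceFst, of_apply, Matrix.sum_apply, Matrix.mul_apply, conjTranspose_apply,
        vecMulVec_apply, Pi.star_apply]
      exact sum_comm
    rw [h1, hρV, tpow_mul, tpow_mul, tpow_diagonal, tpow_conjTranspose]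
    simp only [u, Complex.ofReal_prod]
    rfl
  set π : (Fin l → b) → ℂ := fun y => if u y ≤ cB then 1 else 0 with hπ
  set P := Vl * diagonal π * Vlᴴ with hPdef
  have hPH : Pᴴ = P := by
    have : star π = π := by
      ext y
      simp only [hπ, Pi.star_apply, apply_ite star, star_one, star_zero]
    rw [hPdef, conjTranspose_mul, conjTranspose_mul, conjTranspose_conjTranspose,
      diagonal_conjTranspose, this, Matrix.mul_assoc]
  have hPP : P * P = P := by
    rw [hPdef, hconj, diagonal_mul_diagonal]
    congr 3
    ext y
    simp only [hπ]
    split_ifs <;> simp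
  have hPβ : ∑ j, (P * ψ j) * (P * ψ j)ᴴ
      = Vl * diagonal (fun y => ((if u y ≤ cB then u y else 0 : ℝ) : ℂ)) * Vlᴴ := by
    have h1 : ∀ j, (P * ψ j) * (P * ψ j)ᴴ = P * (ψ j * (ψ j)ᴴ) * P := fun j => by
      rw [conjTranspose_mul, hPH]
      simp only [Matrix.mul_assoc]
    simp only [h1]
    rw [← Matrix.sum_mul, ← Matrix.mul_sum, hβ, hPdef, hconj, hconj, diagonal_mul_diagonal,
      diagonal_mul_diagonal]
    congr 3
    ext y
    simp only [hπ]
    split_ifs <;> simp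
  let ψ' : (Fin l → a × b) → Matrix (Fin l → b) (Fin l → a) ℂ := fun j =>
    if cA ≤ w j then P * ψ j else 0
  have hsplit : ∀ j, w j = ∑ y, ∑ x, ‖ψ' j y x‖ ^ 2 + ∑ y, ∑ x, ‖(ψ - ψ') j y x‖ ^ 2 := fun j => by
    rw [← hnorm j]
    simp only [ψ', Pi.sub_apply]
    split_ifs with h
    · exact sum_norm_sq_projection hPH hPP (ψ j)
    · simp
  have htotal : totalNormSq ψ' + totalNormSq (ψ - ψ') = 1 := by
    rw [totalNormSq, totalNormSq, ← sum_add_distrib, ← hw1]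
    exact sum_congr rfl fun j _ => (hsplit j).symm
  have hlow : 1 - (v₁ + v₂) / l ≤ totalNormSq ψ' := by
    have h1 : ∑ j, ∑ y, ∑ x, ‖(P * ψ j) y x‖ ^ 2 = ∑ y, if u y ≤ cB then u y else 0 := by
      simp only [← trace_mul_conjTranspose_re]
      rw [← Complex.re_sum, ← trace_sum, hPβ, trace_mul_comm, ← Matrix.mul_assoc, hVl1,
        Matrix.one_mul, trace_diagonal, ← Complex.ofReal_sum, Complex.ofReal_re]
    have h2 : ∀ j, ∑ y, ∑ x, ‖(P * ψ j) y x‖ ^ 2 - (if cA ≤ w j then 0 else w j)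
        ≤ ∑ y, ∑ x, ‖ψ' j y x‖ ^ 2 := fun j => by
      simp only [ψ']
      split_ifs with h
      · simp
      · have h3 := sum_norm_sq_projection hPH hPP (ψ j)
        have h4 : 0 ≤ ∑ i, ∑ k, ‖(ψ j - P * ψ j) i k‖ ^ 2 := by positivity
        rw [hnorm] at h3
        simp only [Matrix.zero_apply, norm_zero]
        simp
        linarith
    have h3 := sum_le_sum fun j (_ : j ∈ univ) => h2 j
    rw [sum_sub_distrib, h1] at h3
    have h4 : ∑ y, (if u y ≤ cB then u y else 0) = 1 - ∑ y, if u y ≤ cB then 0 else u y := by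
      rw [← hu1, ← sum_sub_distrib]
      exact sum_congr rfl fun y _ => by split_ifs <;> simp
    rw [h4] at h3
    have h5 : totalNormSq ψ' = ∑ j, ∑ y, ∑ x, ‖ψ' j y x‖ ^ 2 := rfl
    rw [add_div]
    linarith
  have hnn : 0 ≤ totalNormSq (ψ - ψ') := by
    rw [totalNormSq]
    positivity
  refine ⟨ψ, ψ', w, hdec, hw0, hw1, by linarith, hlow, by linarith, fun j => ?_, ?_⟩
  · by_cases h : cA ≤ w j
    · exact Or.inr h
    · exact Or.inl (if_neg h)
  · have h1 : (∑ j, (P * ψ j) * (P * ψ j)ᴴ - ∑ j, ψ' j * (ψ' j)ᴴ).PosSemidef := by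
      rw [← sum_sub_distrib]
      refine posSemidef_sum _ fun j _ => ?_
      simp only [ψ']
      split_ifs with h
      · rw [sub_self]
        exact PosSemidef.zero
      · rw [Matrix.zero_mul, sub_zero]
        exact posSemidef_self_mul_conjTranspose _
    have h2 : ((cB : ℂ) • 1 - ∑ j, (P * ψ j) * (P * ψ j)ᴴ).PosSemidef := by
      have h3 : (cB : ℂ) • (1 : Matrix (Fin l → b) (Fin l → b) ℂ)
          = Vl * diagonal (fun _ => (cB : ℂ)) * Vlᴴ := by
        rw [← smul_one_eq_diagonal, Matrix.mul_smul, Matrix.mul_one, Matrix.smul_mul, hVl2]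
      rw [hPβ, h3, ← Matrix.sub_mul, ← Matrix.mul_sub, diagonal_sub]
      refine (PosSemidef.diagonal fun y => ?_).mul_mul_conjTranspose_same Vl
      rw [Pi.zero_apply, ← Complex.ofReal_sub]
      split_ifs with h
      · exact Complex.zero_le_real.2 (sub_nonneg.2 h)
      · simpa using hcB
    have h4 := h2.add h1
    rwa [sub_add_sub_cancel] at h4

/-! ### Protocols for the averaged state -/

/-- The collision quantity of the one-shot bound, for vectors in groups `i : I`: it is at most the
sum over the groups of (largest inverse weight) times (largest eigenvalue of Bob's marginal). -/
theorem sum_crossMarginal_le {A B I J : Type*} [Fintype A] [Fintype B] [DecidableEq B] [Fintype I]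
    [Fintype J] (ψ : I × J → Matrix B A ℂ) (d : I × J → ℝ) (D c : I → ℝ)
    (hd : ∀ e, ψ e = 0 ∨ (d e)⁻¹ ≤ D e.1) (hD : ∀ i, 0 ≤ D i)
    (hc : ∀ i, ((c i : ℂ) • 1 - ∑ j, ψ (i, j) * (ψ (i, j))ᴴ).PosSemidef) :
    ∑ e, ∑ e', (d e')⁻¹ * ∑ a, ∑ a', ‖crossMarginal ψ e e' a a'‖ ^ 2
      ≤ (∑ i, D i * c i) * totalNormSq ψ := by
  have hcross : ∀ e e', ∑ a, ∑ a', ‖crossMarginal ψ e e' a a'‖ ^ 2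
      = ((ψ e)ᴴ * (ψ e' * (ψ e')ᴴ) * ψ e).trace.re := fun e e' => by
    rw [show (ψ e)ᴴ * (ψ e' * (ψ e')ᴴ) * ψ e = ((ψ e)ᴴ * ψ e') * ((ψ e)ᴴ * ψ e')ᴴ by
      simp only [conjTranspose_mul, conjTranspose_conjTranspose, Matrix.mul_assoc],
      trace_mul_conjTranspose_re]
    refine sum_congr rfl fun a _ => sum_congr rfl fun a' _ => ?_
    rw [← norm_star]
    congr 2
    simp only [crossMarginal, of_apply, Matrix.mul_apply, conjTranspose_apply, star_sum, star_mul',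
      star_star]
  rw [totalNormSq, mul_sum]
  refine sum_le_sum fun e _ => ?_
  rw [Fintype.sum_prod_type, sum_mul]
  refine sum_le_sum fun i _ => ?_
  calc ∑ j, (d (i, j))⁻¹ * ∑ a, ∑ a', ‖crossMarginal ψ e (i, j) a a'‖ ^ 2
      ≤ ∑ j, D i * ∑ a, ∑ a', ‖crossMarginal ψ e (i, j) a a'‖ ^ 2 := by
        refine sum_le_sum fun j _ => ?_
        rcases hd (i, j) with h | h
        · simp [crossMarginal, h]
        · gcongr
    _ = D i * ((ψ e)ᴴ * (∑ j, ψ (i, j) * (ψ (i, j))ᴴ) * ψ e).trace.re := by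
        rw [← mul_sum, Matrix.mul_sum, Matrix.sum_mul, trace_sum, Complex.re_sum]
        simp only [hcross]
    _ ≤ D i * (c i * ∑ b, ∑ a, ‖ψ e b a‖ ^ 2) := by
        refine mul_le_mul_of_nonneg_left ?_ (hD i)
        have h := (Complex.le_def.1 ((hc i).conjTranspose_mul_mul_same (ψ e)).trace_nonneg).1
        rw [Matrix.mul_sub, Matrix.sub_mul, trace_sub, Complex.sub_re, Complex.zero_re, sub_nonneg,
          Matrix.mul_smul, Matrix.mul_one, Matrix.smul_mul, trace_smul, trace_mul_comm (ψ e)ᴴ,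
          smul_eq_mul, Complex.re_ofReal_mul, trace_mul_conjTranspose_re] at h
        exact h
    _ = _ := by ring

theorem totalNormSq_smul_prod {A B I J : Type*} [Fintype A] [Fintype B] [Fintype I] [Fintype J]
    (r : ℝ) (ψ : I → J → Matrix B A ℂ) :
    totalNormSq (fun e : I × J => (r : ℂ) • ψ e.1 e.2) = r ^ 2 * ∑ i, totalNormSq (ψ i) := by
  simp only [totalNormSq, Fintype.sum_prod_type, Matrix.smul_apply, smul_eq_mul, norm_mul, mul_pow,
    Complex.norm_real, Real.norm_eq_abs, sq_abs, mul_sum]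

/-- A protocol for the uniform mixture of the states `(ρ i)^{⊗ l}`. The purifying environment
carries the label `i`; smoothing is done for each `i` separately, so that the error involves the
conditional entropies of the individual states only. -/
theorem exists_protocol_average {a b : Type*} [Fintype a] [DecidableEq a] [Fintype b]
    [DecidableEq b] {N : ℕ} (hN : 0 < N) (ρ : Fin N → Matrix (a × b) (a × b) ℂ)
    (hρ : ∀ i, IsState (ρ i)) {M : ℝ} (hM : ∀ i, condEntropy (ρ i) ≤ M) {δ : ℝ} (hδ : 0 < δ) :
    ∃ v : ℝ, ∀ l : ℕ, 1 ≤ l → ∀ k : ℕ, 1 ≤ k → ∀ ε : ℝ, 0 < ε →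
      ∃ T : Matrix ((Fin l → a) × (Fin l → b)) ((Fin l → a) × (Fin l → b)) ℂ →ₗ[ℂ]
          Matrix (Fin k × Fin k) (Fin k × Fin k) ℂ,
        IsOneWayLOCC T ∧ (∀ X, X.PosSemidef → (T X).PosSemidef) ∧ IsTracePreserving T ∧
        ∀ g : ℝ, 0 ≤ g →
          g ≤ 1 - v / l - k * N / ε * (2 : ℝ) ^ (l * (M + 2 * δ)) - √(1 + ε) * √(v / l) →
          g ^ 2 / (1 + ε) ≤ (N : ℝ)⁻¹ * ∑ i,
            (star (maxEntVec k) ⬝ᵥ T (tensorPow l (ρ i)) *ᵥ maxEntVec k).re := by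
  have hN0 : (0 : ℝ) < N := by exact_mod_cast hN
  choose v hv hvec using fun i => exists_smoothed_vectors (hρ i) hδ
  refine ⟨∑ i, v i, fun l hl k hk ε hε => ?_⟩
  have hl0 : (0 : ℝ) < l := by exact_mod_cast hl
  have hk0 : (0 : ℝ) < k := by exact_mod_cast hk
  have hvi : ∀ i, v i / l ≤ (∑ i, v i) / l := fun i => by
    gcongr
    exact single_le_sum (fun i _ => hv i) (mem_univ i)
  choose ψ ψ' w hdec hw0 hw1 hle1 hlow hdiff htyp hB using fun i => hvec i l hl
  set r : ℝ := (√N)⁻¹ with hr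
  have hr2 : r ^ 2 = (N : ℝ)⁻¹ := by rw [hr, inv_pow, Real.sq_sqrt hN0.le]
  have hrr : (r : ℂ) * r = (N : ℂ)⁻¹ := inv_sqrt_mul_self N
  let Ψ : Fin N × (Fin l → a × b) → Matrix (Fin l → b) (Fin l → a) ℂ :=
    fun e => (r : ℂ) • ψ e.1 e.2
  let Ψ' : Fin N × (Fin l → a × b) → Matrix (Fin l → b) (Fin l → a) ℂ :=
    fun e => (r : ℂ) • ψ' e.1 e.2
  -- Weights comparable to the eigenvalues, kept positive where an eigenvalue vanishes.
  let d : Fin N × (Fin l → a × b) → ℝ := fun e =>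
    ε * ((N : ℝ)⁻¹ * ((w e.1 e.2 + (Fintype.card (Fin l → a × b) : ℝ)⁻¹) / 2))
  have hJ : Nonempty (Fin l → a × b) := by
    by_contra h
    rw [not_nonempty_iff] at h
    have := hw1 ⟨0, hN⟩
    simp at this
  have hJ0 : (0 : ℝ) < Fintype.card (Fin l → a × b) := by exact_mod_cast Fintype.card_pos
  have hd : ∀ e, 0 < d e := fun e => by
    have := hw0 e.1 e.2
    positivity
  have hdsum : ∑ e, d e = ε := by
    simp only [d, Fintype.sum_prod_type, ← mul_sum, ← sum_div, sum_add_distrib, hw1, sum_const,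
      card_univ, nsmul_eq_mul, Fintype.card_fin, Fintype.card_prod, Nat.cast_mul]
    field_simp
    ring
  have havg : ∀ f : Fin N → ℝ, ∀ x : ℝ, (∀ i, f i ≤ x) → r ^ 2 * ∑ i, f i ≤ x := fun f x hf => by
    rw [hr2, inv_mul_le_iff₀ hN0]
    simpa using sum_le_card_nsmul univ f x fun i _ => hf i
  have ht1 : totalNormSq Ψ' ≤ 1 := by
    rw [totalNormSq_smul_prod]
    exact havg _ _ hle1
  have ht0 : 1 - (∑ i, v i) / l ≤ totalNormSq Ψ' := by
    rw [totalNormSq_smul_prod, hr2, le_inv_mul_iff₀ hN0]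
    simpa using card_nsmul_le_sum univ (fun i => totalNormSq (ψ' i)) (1 - (∑ i, v i) / l)
      fun i _ => by linarith [hlow i, hvi i]
  have htd : totalNormSq (Ψ - Ψ') ≤ (∑ i, v i) / l := by
    have : Ψ - Ψ' = fun e => (r : ℂ) • (ψ e.1 - ψ' e.1) e.2 := by
      ext1 e
      simp [Ψ, Ψ', smul_sub]
    rw [this, totalNormSq_smul_prod r fun i => ψ i - ψ' i]
    exact havg _ _ fun i => (hdiff i).trans (hvi i)
  have htnn : 0 ≤ totalNormSq Ψ' := by
    rw [totalNormSq]
    positivity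
  have hQ : ∑ e, ∑ e', (d e')⁻¹ * ∑ a, ∑ a', ‖crossMarginal Ψ' e e' a a'‖ ^ 2
      ≤ 2 * N / ε * (2 : ℝ) ^ (l * (M + 2 * δ)) := by
    have h1 := sum_crossMarginal_le Ψ' d
      (fun i => 2 * N / ε * (2 : ℝ) ^ (l * (entropy (ρ i) + δ)))
      (fun i => (N : ℝ)⁻¹ * (2 : ℝ) ^ (-(l * (entropy (traceFst (ρ i)) - δ))))
      (fun e => by
        rcases htyp e.1 e.2 with h | h
        · exact Or.inl (by simp [Ψ', h])
        · right
          have h2 : (2 * N / ε * (2 : ℝ) ^ (l * (entropy (ρ e.1) + δ)))⁻¹ ≤ d e := by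
            rw [mul_inv, ← Real.rpow_neg zero_le_two]
            calc (2 * N / ε)⁻¹ * (2 : ℝ) ^ (-(l * (entropy (ρ e.1) + δ)))
                ≤ (2 * N / ε)⁻¹ * (w e.1 e.2 + (Fintype.card (Fin l → a × b) : ℝ)⁻¹) := by
                  gcongr
                  exact h.trans (le_add_of_nonneg_right (by positivity))
              _ = d e := by
                  simp only [d]
                  field_simp
          exact inv_le_of_inv_le₀ (by positivity) h2)
      (fun i => by positivity)
      (fun i => by
        have h2 : ∑ j, Ψ' (i, j) * (Ψ' (i, j))ᴴ
            = (N : ℂ)⁻¹ • ∑ j, ψ' i j * (ψ' i j)ᴴ := by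
          rw [smul_sum]
          refine sum_congr rfl fun j _ => ?_
          simp only [Ψ', conjTranspose_smul, Complex.star_def, Complex.conj_ofReal]
          rw [Matrix.smul_mul, Matrix.mul_smul, smul_smul, hrr]
        rw [h2, Complex.ofReal_mul, mul_smul, Complex.ofReal_inv, Complex.ofReal_natCast,
          ← smul_sub]
        refine (hB i).smul ?_
        rw [← Complex.ofReal_natCast, ← Complex.ofReal_inv]
        exact Complex.zero_le_real.2 (by positivity))
    have h3 : ∑ i, (2 * N / ε * (2 : ℝ) ^ (l * (entropy (ρ i) + δ)))
        * ((N : ℝ)⁻¹ * (2 : ℝ) ^ (-(l * (entropy (traceFst (ρ i)) - δ))))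
        ≤ 2 * N / ε * (2 : ℝ) ^ (l * (M + 2 * δ)) := by
      have h4 : ∀ i, (2 * N / ε * (2 : ℝ) ^ (l * (entropy (ρ i) + δ)))
          * ((N : ℝ)⁻¹ * (2 : ℝ) ^ (-(l * (entropy (traceFst (ρ i)) - δ))))
          ≤ 2 / ε * (2 : ℝ) ^ (l * (M + 2 * δ)) := fun i => by
        have h5 : (2 : ℝ) ^ (l * (entropy (ρ i) + δ))
            * (2 : ℝ) ^ (-(l * (entropy (traceFst (ρ i)) - δ)))
            ≤ (2 : ℝ) ^ (l * (M + 2 * δ)) := by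
          rw [← Real.rpow_add two_pos]
          refine Real.rpow_le_rpow_of_exponent_le one_le_two ?_
          have h6 := hM i
          rw [condEntropy] at h6
          nlinarith
        calc _ = 2 / ε * ((2 : ℝ) ^ (l * (entropy (ρ i) + δ))
              * (2 : ℝ) ^ (-(l * (entropy (traceFst (ρ i)) - δ)))) := by
              field_simp
          _ ≤ _ := by gcongr
      refine (sum_le_card_nsmul univ _ _ fun i _ => h4 i).trans_eq ?_
      rw [card_univ, Fintype.card_fin, nsmul_eq_mul]
      ring
    refine h1.trans ((mul_le_of_le_one_right ?_ ht1).trans h3)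
    exact sum_nonneg fun i _ => by positivity
  obtain ⟨T, hT, hTpos, hTtp, hTF⟩ := exists_oneShot_protocol hk Ψ Ψ' d hd
    (by rw [hdsum]; linarith)
  refine ⟨T, hT, hTpos, hTtp, fun g hg0 hg => ?_⟩
  have hstate : ∑ e, vecMulVec (fun x : (Fin l → a) × (Fin l → b) => Ψ e x.2 x.1)
      (star fun x : (Fin l → a) × (Fin l → b) => Ψ e x.2 x.1)
      = (N : ℂ)⁻¹ • ∑ i, tensorPow l (ρ i) := by
    rw [Fintype.sum_prod_type, smul_sum]
    refine sum_congr rfl fun i _ => ?_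
    rw [hdec i, smul_sum]
    refine sum_congr rfl fun j _ => ?_
    ext x y
    simp only [Ψ, vecMulVec_apply, Pi.star_apply, Matrix.smul_apply, smul_eq_mul, star_mul',
      Complex.star_def, Complex.conj_ofReal, ← hrr]
    ring
  have hfin := hTF g hg0 (by
    rw [hdsum]
    have h1 : √(totalNormSq Ψ' + ε) * √(totalNormSq (Ψ - Ψ'))
        ≤ √(1 + ε) * √((∑ i, v i) / l) := by gcongr
    have h2 := mul_le_mul_of_nonneg_left hQ (by positivity : (0 : ℝ) ≤ k / 2)
    have h3 : (k : ℝ) / 2 * (2 * N / ε * (2 : ℝ) ^ (l * (M + 2 * δ)))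
        = k * N / ε * (2 : ℝ) ^ (l * (M + 2 * δ)) := by ring
    linarith)
  rw [hstate, hdsum, map_smul, map_sum, smul_mulVec, dotProduct_smul, sum_mulVec, dotProduct_sum,
    smul_eq_mul, ← Complex.ofReal_natCast, ← Complex.ofReal_inv, Complex.re_ofReal_mul,
    Complex.re_sum] at hfin
  refine le_trans ?_ hfin
  gcongr

/-! ### Achievable rates -/

theorem isState_tensorPow {a b : Type*} [Fintype a] [DecidableEq a] [Fintype b] [DecidableEq b]
    {ρ : Matrix (a × b) (a × b) ℂ} (hρ : IsState ρ) (l : ℕ) : IsState (tensorPow l ρ) := by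
  have h : tensorPow l ρ = (tpow l ρ).submatrix
      (fun x : (Fin l → a) × (Fin l → b) => fun t => (x.1 t, x.2 t))
      (fun x : (Fin l → a) × (Fin l → b) => fun t => (x.1 t, x.2 t)) := rfl
  constructor
  · obtain ⟨B, hB, hBB⟩ := exists_sqrt hρ.1
    have h1 : tpow l ρ = (tpow l B)ᴴ * tpow l B := by
      rw [← tpow_conjTranspose, ← tpow_mul, hB.isHermitian.eq, hBB]
    rw [h, h1]
    exact (posSemidef_conjTranspose_mul_self _).submatrix _
  · have h2 : traceFst (tensorPow l ρ) = tpow l (traceFst ρ) := traceFst_tensorPow l ρ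
    have h3 : ∀ {c d : Type _} [Fintype c] [Fintype d] (X : Matrix (c × d) (c × d) ℂ),
        X.trace = (traceFst X).trace := fun X => by
      simp only [trace, traceFst, diag_apply, of_apply, Fintype.sum_prod_type]
      exact sum_comm
    rw [h3, h2]
    simp only [trace, tpow, diag_apply, of_apply]
    rw [sum_pi_prod fun _ y => traceFst ρ y y]
    have h4 := hρ.2
    rw [h3] at h4
    simp only [trace, diag_apply] at h4
    simp [h4]

/-- A sequence of protocols whose expectation values in the maximally entangled state tend to one
uniformly over the finitely many states achieves the rate of its dimensions. -/
theorem isAchievableRate_of_tendsto {a b : Type*} [Fintype a] [DecidableEq a] [Fintype b]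
    [DecidableEq b] {N : ℕ} (hN : 0 < N) (ρ : Fin N → Matrix (a × b) (a × b) ℂ)
    (hρ : ∀ i, IsState (ρ i)) {R : ℝ} (hR : 0 ≤ R) (k : ℕ → ℕ) (hk : ∀ l, 1 ≤ l → 1 ≤ k l)
    (hkR : ∀ l : ℕ, 1 ≤ l → R ≤ 1 / (l : ℝ) * Real.logb 2 (k l))
    (T : ∀ l : ℕ, Matrix ((Fin l → a) × (Fin l → b)) ((Fin l → a) × (Fin l → b)) ℂ →ₗ[ℂ]
      Matrix (Fin (k l) × Fin (k l)) (Fin (k l) × Fin (k l)) ℂ)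
    (hT : ∀ l, 1 ≤ l → IsOneWayLOCC (T l))
    (hTpos : ∀ l, 1 ≤ l → ∀ X, X.PosSemidef → (T l X).PosSemidef)
    (hTtp : ∀ l, 1 ≤ l → IsTracePreserving (T l)) (h : ℕ → ℝ)
    (hlim : Filter.Tendsto h Filter.atTop (𝓝 1))
    (hh : ∀ᶠ l in Filter.atTop, ∀ i, h l ≤
      (star (maxEntVec (k l)) ⬝ᵥ T l (tensorPow l (ρ i)) *ᵥ maxEntVec (k l)).re) :
    IsAchievableRate (Set.range ρ) R := by
  have hfid : ∀ l, 1 ≤ l → ∀ i, fidelity (T l (tensorPow l (ρ i)))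
      (vecMulVec (maxEntVec (k l)) (star (maxEntVec (k l))))
      = (star (maxEntVec (k l)) ⬝ᵥ T l (tensorPow l (ρ i)) *ᵥ maxEntVec (k l)).re := fun l hl i =>
    fidelity_vecMulVec (hTpos l hl _ (isState_tensorPow (hρ i) l).1)
      (star_maxEntVec_dotProduct_self (hk l hl))
  have hle : ∀ l, 1 ≤ l → ∀ i, fidelity (T l (tensorPow l (ρ i)))
      (vecMulVec (maxEntVec (k l)) (star (maxEntVec (k l)))) ≤ 1 := fun l hl i => by
    rw [hfid l hl]
    refine (re_dotProduct_mulVec_le_trace (hTpos l hl _ (isState_tensorPow (hρ i) l).1)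
      (star_maxEntVec_dotProduct_self (hk l hl))).trans_eq ?_
    rw [hTtp l hl, (isState_tensorPow (hρ i) l).2, Complex.one_re]
  refine ⟨hR, k, T, fun l => vecMulVec (maxEntVec (k l)) (star (maxEntVec (k l))),
    fun l hl => ⟨hk l hl, hT l hl, isMaxEntangled_maxEntVec (hk l hl)⟩, ?_, ?_⟩
  · refine Filter.le_liminf_of_le (by isBoundedDefault) ?_
    filter_upwards [Filter.eventually_ge_atTop 1] with l hl
    exact EReal.coe_le_coe_iff.2 (hkR l hl)
  · have : Nonempty (Set.range ρ) := ⟨⟨ρ ⟨0, hN⟩, ⟨0, hN⟩, rfl⟩⟩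
    refine tendsto_of_tendsto_of_tendsto_of_le_of_le' hlim tendsto_const_nhds ?_ ?_
    · filter_upwards [hh, Filter.eventually_ge_atTop 1] with l hl hl1
      refine le_ciInf fun x => ?_
      obtain ⟨_, i, rfl⟩ := x
      rw [hfid l hl1]
      exact hl i
    · filter_upwards [Filter.eventually_ge_atTop 1] with l hl1
      refine ciInf_le_of_le ⟨0, ?_⟩ ⟨ρ ⟨0, hN⟩, ⟨0, hN⟩, rfl⟩ (hle l hl1 _)
      rintro _ ⟨x, rfl⟩
      exact sq_nonneg _

/-- One-dimensional outputs are always perfectly entangled. -/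
theorem isAchievableRate_zero {a b : Type*} [Fintype a] [DecidableEq a] [Fintype b]
    [DecidableEq b] {N : ℕ} (hN : 0 < N) (ρ : Fin N → Matrix (a × b) (a × b) ℂ)
    (hρ : ∀ i, IsState (ρ i)) {M : ℝ} (hM : ∀ i, condEntropy (ρ i) ≤ M) :
    IsAchievableRate (Set.range ρ) 0 := by
  obtain ⟨v, hv⟩ := exists_protocol_average hN ρ hρ hM one_pos
  have hex : ∀ l : ℕ, ∃ T : Matrix ((Fin l → a) × (Fin l → b)) ((Fin l → a) × (Fin l → b)) ℂ →ₗ[ℂ]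
      Matrix (Fin 1 × Fin 1) (Fin 1 × Fin 1) ℂ, 1 ≤ l → IsOneWayLOCC T ∧
        (∀ X, X.PosSemidef → (T X).PosSemidef) ∧ IsTracePreserving T := fun l => by
    by_cases hl : 1 ≤ l
    · obtain ⟨T, h1, h2, h3, -⟩ := hv l hl 1 le_rfl 1 one_pos
      exact ⟨T, fun _ => ⟨h1, h2, h3⟩⟩
    · exact ⟨0, fun h => absurd h hl⟩
  choose T hT using hex
  refine isAchievableRate_of_tendsto hN ρ hρ le_rfl (fun _ => 1) (fun _ _ => le_rfl)
    (fun l _ => by simp) T (fun l hl => (hT l hl).1) (fun l hl => (hT l hl).2.1)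
    (fun l hl => (hT l hl).2.2) (fun _ => 1) tendsto_const_nhds ?_
  filter_upwards [Filter.eventually_ge_atTop 1] with l hl i
  have h1 : (star (maxEntVec 1) ⬝ᵥ T l (tensorPow l (ρ i)) *ᵥ maxEntVec 1)
      = (T l (tensorPow l (ρ i))).trace := by
    simp [dotProduct, mulVec, trace, maxEntVec, Fintype.sum_prod_type]
  rw [h1, (hT l hl).2.2, (isState_tensorPow (hρ i) l).2, Complex.one_re]

/-- Every rate below the smallest coherent information is achievable. -/
theorem isAchievableRate_of_lt {a b : Type*} [Fintype a] [DecidableEq a] [Fintype b]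
    [DecidableEq b] {N : ℕ} (hN : 0 < N) (ρ : Fin N → Matrix (a × b) (a × b) ℂ)
    (hρ : ∀ i, IsState (ρ i)) {M : ℝ} (hM : ∀ i, condEntropy (ρ i) ≤ M) {R : ℝ} (hR : 0 ≤ R)
    (hRM : R < -M) : IsAchievableRate (Set.range ρ) R := by
  set δ : ℝ := (-M - R) / 4 with hδdef
  have hδ : 0 < δ := by
    rw [hδdef]
    linarith
  have hN0 : (0 : ℝ) < N := by exact_mod_cast hN
  obtain ⟨v, hv⟩ := exists_protocol_average hN ρ hρ hM hδ
  -- With `R + M = -4 δ` the choice `ε l = 2 ^ (-l δ)` balances the regularisation against the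
  -- collision term `k l * N / ε l * 2 ^ (l (M + 2 δ))`, which becomes at most `2 N * ε l`.
  let k : ℕ → ℕ := fun l => ⌈(2 : ℝ) ^ (l * R)⌉₊
  have hkle : ∀ l : ℕ, (2 : ℝ) ^ (l * R) ≤ k l := fun l => Nat.le_ceil _
  have hk1 : ∀ l, 1 ≤ k l := fun l => Nat.ceil_pos.2 (by positivity)
  have hkub : ∀ l : ℕ, (k l : ℝ) ≤ 2 * (2 : ℝ) ^ (l * R) := fun l => by
    have h1 : (1 : ℝ) ≤ (2 : ℝ) ^ (l * R) := Real.one_le_rpow one_le_two (by positivity)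
    have h2 := (Nat.ceil_lt_add_one (by positivity : (0 : ℝ) ≤ (2 : ℝ) ^ (l * R))).le
    linarith
  let ε : ℕ → ℝ := fun l => (2 : ℝ) ^ (-(l * δ))
  have hε : ∀ l, 0 < ε l := fun l => by positivity
  have hεlim : Filter.Tendsto ε Filter.atTop (𝓝 0) := by
    have h1 : ε = fun l : ℕ => ((2 : ℝ) ^ (-δ)) ^ l := by
      ext l
      change (2 : ℝ) ^ (-(l * δ)) = _
      rw [← Real.rpow_natCast, ← Real.rpow_mul zero_le_two]
      congr 1
      ring
    rw [h1]
    exact tendsto_pow_atTop_nhds_zero_of_lt_one (by positivity)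
      (Real.rpow_lt_one_of_one_lt_of_neg one_lt_two (by linarith))
  have hvlim : Filter.Tendsto (fun l : ℕ => v / l) Filter.atTop (𝓝 0) :=
    tendsto_const_div_atTop_nhds_zero_nat v
  let g : ℕ → ℝ := fun l => 1 - v / l - 2 * N * ε l - √(1 + ε l) * √(v / l)
  have hglim : Filter.Tendsto g Filter.atTop (𝓝 1) := by
    have h1 := ((tendsto_const_nhds (x := (1 : ℝ))).sub hvlim).sub (hεlim.const_mul (2 * (N : ℝ)))
    have h2 := (hεlim.const_add 1).sqrt.mul hvlim.sqrt
    have h3 := h1.sub h2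
    rwa [show (1 : ℝ) - 0 - 2 * N * 0 - √(1 + 0) * √0 = 1 by simp] at h3
  let h : ℕ → ℝ := fun l => 1 - N * (1 - g l ^ 2 / (1 + ε l))
  have hlim : Filter.Tendsto h Filter.atTop (𝓝 1) := by
    have h1 := (hglim.pow 2).div (hεlim.const_add 1) (by norm_num)
    have h2 := (h1.const_sub 1).const_mul (N : ℝ)
    simpa using h2.const_sub 1
  have hex : ∀ l : ℕ, ∃ T : Matrix ((Fin l → a) × (Fin l → b)) ((Fin l → a) × (Fin l → b)) ℂ →ₗ[ℂ]
      Matrix (Fin (k l) × Fin (k l)) (Fin (k l) × Fin (k l)) ℂ, 1 ≤ l → IsOneWayLOCC T ∧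
        (∀ X, X.PosSemidef → (T X).PosSemidef) ∧ IsTracePreserving T ∧
        (0 ≤ g l → g l ^ 2 / (1 + ε l) ≤ (N : ℝ)⁻¹ * ∑ i,
            (star (maxEntVec (k l)) ⬝ᵥ T (tensorPow l (ρ i)) *ᵥ maxEntVec (k l)).re) := fun l => by
    by_cases hl : 1 ≤ l
    · obtain ⟨T, h1, h2, h3, h4⟩ := hv l hl (k l) (hk1 l) (ε l) (hε l)
      refine ⟨T, fun _ => ⟨h1, h2, h3, fun hg => h4 (g l) hg ?_⟩⟩
      have h5 : k l * N / ε l * (2 : ℝ) ^ (l * (M + 2 * δ)) ≤ 2 * N * ε l := by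
        calc k l * N / ε l * (2 : ℝ) ^ (l * (M + 2 * δ))
            ≤ 2 * (2 : ℝ) ^ (l * R) * N / ε l * (2 : ℝ) ^ (l * (M + 2 * δ)) := by
              gcongr
              exact hkub l
          _ = 2 * N * ((2 : ℝ) ^ (l * R) * (ε l)⁻¹ * (2 : ℝ) ^ (l * (M + 2 * δ))) := by ring
          _ = 2 * N * ε l := by
              simp only [ε]
              rw [← Real.rpow_neg zero_le_two, ← Real.rpow_add two_pos, ← Real.rpow_add two_pos]
              congr 2
              rw [hδdef]
              ring
      simp only [g]
      linarith
    · exact ⟨0, fun h => absurd h hl⟩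
  choose T hT using hex
  refine isAchievableRate_of_tendsto hN ρ hρ hR k (fun l _ => hk1 l) (fun l hl => ?_) T
    (fun l hl => (hT l hl).1) (fun l hl => (hT l hl).2.1) (fun l hl => (hT l hl).2.2.1) h hlim ?_
  · have hl0 : (0 : ℝ) < l := by exact_mod_cast hl
    have h1 : l * R ≤ Real.logb 2 (k l) :=
      (Real.le_logb_iff_rpow_le one_lt_two (by exact_mod_cast hk1 l)).2 (hkle l)
    rw [one_div, le_inv_mul_iff₀ hl0]
    exact h1
  · filter_upwards [Filter.eventually_ge_atTop 1,
      hglim.eventually (eventually_ge_nhds (zero_lt_one (α := ℝ)))] with l hl hg i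
    have h1 := (hT l hl).2.2.2 hg
    -- The other states contribute at most one each to the average.
    have h2 : ∀ j, (star (maxEntVec (k l)) ⬝ᵥ T l (tensorPow l (ρ j)) *ᵥ maxEntVec (k l)).re ≤ 1 :=
      fun j => by
      refine (re_dotProduct_mulVec_le_trace ((hT l hl).2.1 _ (isState_tensorPow (hρ j) l).1)
        (star_maxEntVec_dotProduct_self (hk1 l))).trans_eq ?_
      rw [(hT l hl).2.2.1, (isState_tensorPow (hρ j) l).2, Complex.one_re]
    have h3 := single_le_sum (f := fun j =>
      1 - (star (maxEntVec (k l)) ⬝ᵥ T l (tensorPow l (ρ j)) *ᵥ maxEntVec (k l)).re)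
      (fun j _ => sub_nonneg.2 (h2 j)) (mem_univ i)
    rw [le_inv_mul_iff₀ hN0] at h1
    simp only [sum_sub_distrib, sum_const, card_univ, Fintype.card_fin, nsmul_eq_mul] at h3
    simp only [h]
    linarith

end QInfo

end

theorem mainTheorem6 {a b : Type*} [Fintype a] [DecidableEq a] [Fintype b] [DecidableEq b]
    (N : ℕ) (hN : 0 < N) (ρ : Fin N → Matrix (a × b) (a × b) ℂ)
    (hρ : ∀ i, QInfo.IsState (ρ i)) :
    ((-(Finset.univ.sup' ⟨⟨0, hN⟩, Finset.mem_univ _⟩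
        (fun i => QInfo.condEntropy (ρ i))) : ℝ) : EReal)
      ≤ QInfo.oneWayDistillable (Set.range ρ) := by
  set M := Finset.univ.sup' ⟨⟨0, hN⟩, Finset.mem_univ _⟩ (fun i => QInfo.condEntropy (ρ i))
  have hM : ∀ i, QInfo.condEntropy (ρ i) ≤ M := fun i =>
    Finset.le_sup' (fun i => QInfo.condEntropy (ρ i)) (Finset.mem_univ i)
  have hsup : ∀ R : ℝ, QInfo.IsAchievableRate (Set.range ρ) R →
      (R : EReal) ≤ QInfo.oneWayDistillable (Set.range ρ) := fun R hR => le_sSup ⟨R, rfl, hR⟩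
  refine le_of_forall_lt fun c hc => ?_
  obtain ⟨x, hcx, hx⟩ := EReal.lt_iff_exists_real_btwn.1 hc
  have hx' : x < -M := EReal.coe_lt_coe_iff.1 hx
  rcases le_total x 0 with h | h
  · exact hcx.trans_le ((EReal.coe_le_coe_iff.2 h).trans
      (hsup 0 (QInfo.isAchievableRate_zero hN ρ hρ hM)))
  · exact hcx.trans_le (hsup x (QInfo.isAchievableRate_of_lt hN ρ hρ hM h hx'))
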